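/- Let $n\ge 2$ and, for $m=1,2$, let $L_m=\sum_{|j|\le J_m}a_{jm}D^j$ be a linear partial differential operator on $\mathbb R^n$ with constant coefficients $a_{jm}\in\mathbb C$ and of order $J_m\ge 1$ (so its symbol $L_m(z)=\sum_{|j|\le J_m}a_{jm}z^j$ is a nonconstant polynomial on $\mathbb C^n$), where $D^j=\partial_1^{j_1}\cdots\partial_n^{j_n}$. Let $\mathcal L_m=\{z\in\mathbb C^n: L_m(z)=0\}$ be its characteristic variety. Write $\mathcal L_1\nparallel\mathcal L_2$ if there are regular (nonsingular) points $z^{(1)}\in\mathcal L_1$ and $z^{(2)}\in\mathcal L_2$ whose tangent spaces $T_1,T_2\subset\mathbb C^n$ are transversal, i.e. $T_1+T_2=\mathbb C^n$. For a bounded domain (nonempty connected open set) $D\subset\mathbb R^n$, let $N_D(L_m)$ be the set of all functions $w\in L^1_{\mathrm{loc}}(D)$ (complex-valued) with $L_mw=0$ in $D$ in the sense of distributions. For $1\le p<\infty$, call the products of null-space elements total in $L^p(D)$ if the linear span of $\{w_1w_2: w_m\in N_D(L_m),\ w_1w_2\in L^p(D)\}$ is dense in $L^p(D)$. The pair $\{L_1,L_2\}$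 has property $C$ (in $D$) if the products are total in $L^p(D)$ for some $p\in[1,\infty)$. Then, for every bounded domain $D\subset\mathbb R^n$: (a) $\{L_1,L_2\}$ has property $C$ in $D$ if and only if $\mathcal L_1\nparallel\mathcal L_2$; and, for every $p\in[1,\infty)$, the products of null-space elements are total in $L^p(D)$ if and only if $\mathcal L_1\nparallel\mathcal L_2$. Moreover: (b) $\mathcal L_1\nparallel\mathcal L_2$ fails if and only if $\mathcal L_1\cup\mathcal L_2$ is a union of parallel (affine) hyperplanes in $\mathbb C^n$. -/

import Mathlib

open MeasureTheory
open scoped ENNReal ContDiff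

noncomputable section

/-- The partial derivative of `u` with respect to the `i`-th coordinate. -/
def partialDeriv {n : ℕ} (i : Fin n) (u : (Fin n → ℝ) → ℂ) : (Fin n → ℝ) → ℂ :=
  fun x => fderiv ℝ u x (Pi.single i 1)

/-- The multi-index derivative `D^j u = ∂₁^{j₁} ⋯ ∂ₙ^{jₙ} u`. -/
def multiDeriv {n : ℕ} (j : Fin n →₀ ℕ) (u : (Fin n → ℝ) → ℂ) : (Fin n → ℝ) → ℂ :=
  (List.finRange n).foldr (fun i v => (partialDeriv i)^[j i] v) u

/-- A formal linear partial differential operator with constant complex coefficients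
`L = ∑ a_j D^j` is given by its symbol `P(z) = ∑ a_j z^j`. This is the formal transpose
`Lᵗ φ = ∑ (-1)^{|j|} a_j D^j φ`. -/
def transposeOp {n : ℕ} (P : MvPolynomial (Fin n) ℂ) (φ : (Fin n → ℝ) → ℂ) :
    (Fin n → ℝ) → ℂ :=
  fun x => ∑ j ∈ P.support, (-1) ^ (∑ i, j i) * P.coeff j * multiDeriv j φ x

/-- The null-space `N_D(L)`: the locally integrable functions `w` on `D` that satisfy `L w = 0`
in `D` in the sense of distributions. -/
def nullSpace {n : ℕ} (D : Set (Fin n → ℝ)) (P : MvPolynomial (Fin n) ℂ) :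
    Set ((Fin n → ℝ) → ℂ) :=
  {w | LocallyIntegrableOn w D volume ∧
    ∀ φ : (Fin n → ℝ) → ℂ, ContDiff ℝ ∞ φ → HasCompactSupport φ → tsupport φ ⊆ D →
      ∫ x in D, w x * transposeOp P φ x = 0}

/-- The elements of `L^p(D)` that are products `w₁ w₂` with `w_m ∈ N_D(L_m)`. -/
def nullProducts {n : ℕ} (D : Set (Fin n → ℝ)) (p : ℝ≥0∞) (P₁ P₂ : MvPolynomial (Fin n) ℂ) :
    Set (Lp ℂ p (volume.restrict D)) :=
  {g | ∃ w₁ ∈ nullSpace D P₁, ∃ w₂ ∈ nullSpace D P₂,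
    g =ᵐ[volume.restrict D] fun x => w₁ x * w₂ x}

/-- The products of null-space elements are total in `L^p(D)`: their finite linear combinations
are dense. -/
def ProductsTotal {n : ℕ} (D : Set (Fin n → ℝ)) (p : ℝ≥0∞) [Fact (1 ≤ p)]
    (P₁ P₂ : MvPolynomial (Fin n) ℂ) : Prop :=
  Dense (Submodule.span ℂ (nullProducts D p P₁ P₂) : Set (Lp ℂ p (volume.restrict D)))

/-- Property C for the pair of operators with symbols `P₁`, `P₂`: the products of null-space
elements are total in `L^p(D)` for some `1 ≤ p < ∞`. -/
def HasPropertyC {n : ℕ} (D : Set (Fin n → ℝ)) (P₁ P₂ : MvPolynomial (Fin n) ℂ) : Prop :=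
  ∃ (p : ℝ≥0∞) (_ : Fact (1 ≤ p)), p ≠ ⊤ ∧ ProductsTotal D p P₁ P₂

/-- The characteristic variety `{z ∈ ℂⁿ : P(z) = 0}`. -/
def charVariety {n : ℕ} (P : MvPolynomial (Fin n) ℂ) : Set (Fin n → ℂ) :=
  {z | MvPolynomial.eval z P = 0}

/-- The tangent space at `z` to `V ⊆ ℂⁿ`: the vectors annihilated by the differential at `z` of
every polynomial that vanishes on `V`. -/
def tangentSpaceAt {n : ℕ} (V : Set (Fin n → ℂ)) (z : Fin n → ℂ) : Submodule ℂ (Fin n → ℂ) where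
  carrier := {v | ∀ q ∈ MvPolynomial.vanishingIdeal ℂ V,
    ∑ i, MvPolynomial.eval z (MvPolynomial.pderiv i q) * v i = 0}
  zero_mem' := by
    intro q _
    simp
  add_mem' := by
    intro v w hv hw q hq
    simp only [Pi.add_apply, mul_add, Finset.sum_add_distrib, hv q hq, hw q hq, add_zero]
  smul_mem' := by
    intro c v hv q hq
    have h := hv q hq
    simp only [Pi.smul_apply, smul_eq_mul, mul_left_comm _ c, ← Finset.mul_sum, h, mul_zero]

/-- `z` is a regular (nonsingular) point of the hypersurface `V`: the tangent space there is
`(n - 1)`-dimensional. -/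
def IsRegularPoint {n : ℕ} (V : Set (Fin n → ℂ)) (z : Fin n → ℂ) : Prop :=
  z ∈ V ∧ Module.finrank ℂ (tangentSpaceAt V z) + 1 = n

/-- `V₁ ∦ V₂`: some tangent spaces to `V₁` and `V₂` at regular points
are transversal, i.e. they span `ℂⁿ` together. -/
def VarietiesTransversal {n : ℕ} (V₁ V₂ : Set (Fin n → ℂ)) : Prop :=
  ∃ z₁ z₂, IsRegularPoint V₁ z₁ ∧ IsRegularPoint V₂ z₂ ∧
    tangentSpaceAt V₁ z₁ ⊔ tangentSpaceAt V₂ z₂ = ⊤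

/-- `V` is a union of parallel affine hyperplanes `{z : c · z = s}`, `s ∈ S`, with a common
normal `c ≠ 0`. -/
def IsUnionOfParallelHyperplanes {n : ℕ} (V : Set (Fin n → ℂ)) : Prop :=
  ∃ c : Fin n → ℂ, c ≠ 0 ∧ ∃ S : Set ℂ, V = ⋃ s ∈ S, {z | ∑ i, c i * z i = s}

end

/-! Geometry. Over `ℂ` the ideal of the hypersurface `{P = 0}` is generated by one polynomial `p`,
the radical of `P` (`exists_reduced_equation`), and the regular points are those where `dp ≠ 0`. If
no two tangent spaces are transversal, all gradients of `p₁` and `p₂` on their varieties are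
multiples of one functional `γ`. The minors `γ_k ∂_i p - γ_i ∂_k p` then vanish on the variety and
have degree less than that of `p`, hence vanish identically. So each `p` is a polynomial in `γ`
alone, and each `P` divides a product of affine factors `c · z - s`
(`exists_list_of_not_transversal`). Conversely, where `dp` and `γ` are independent, the zeros of `p`
meet every nearby hyperplane `γ = const`. A union of such hyperplanes containing those zeros would
contain an open set, which a proper hypersurface cannot. This gives (b).

Transversality implies totality. If `z₁` and `z₂` lie on the two varieties, then `exp (z₁ · x) exp
(z₂ · x) = exp ((z₁ + z₂) · x)` is a product of null-space elements. By the implicit function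
theorem the sums `z₁ + z₂` fill an open set. Modulo the closed span of the products, `z ↦ exp (z ·
x)` is an analytic function that vanishes on this open set, so it vanishes everywhere. The
exponentials are total by Stone–Weierstrass (`productsTotal_of_transversal`).

Failure of transversality excludes totality. The null-space elements then satisfy `∏ (∂ - s) w = 0`
for a single complex vector field `∂ = c · ∇`. After a real linear change of variables `∂` acts on
one factor `V` of `W × V`, where it is `d/dx` on `ℝ` or, up to a factor, Cauchy–Riemann on `ℂ`. Both
have a fundamental solution, so on almost every slice the solutions are smooth
(`exists_smooth_slices`). By the Leibniz rule, products of smooth solutions satisfy a further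
equation `∏_{q ∈ Q} (∂ - q) = 0` (`exists_constOp_mul`). A test function in the range of its
transpose is therefore orthogonal to all products, but not to `exp (κ l)` with `∂ l = 1` and `κ ∉ Q`
(`exists_orthogonal_testFunction`). -/

/-! ### Gradients and reduced equations of hypersurfaces -/

open MvPolynomial in
/-- The differential at `z` of a complex polynomial in `n` variables. -/
noncomputable def polyGrad {n : ℕ} (p : MvPolynomial (Fin n) ℂ) (z : Fin n → ℂ) :
    (Fin n → ℂ) →L[ℂ] ℂ :=
  ∑ i, eval z (pderiv i p) • ContinuousLinearMap.proj i

theorem polyGrad_apply {n : ℕ} (p : MvPolynomial (Fin n) ℂ) (z v : Fin n → ℂ) :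
    polyGrad p z v = ∑ i, MvPolynomial.eval z (MvPolynomial.pderiv i p) * v i := by
  simp [polyGrad]

theorem polyGrad_single {n : ℕ} (p : MvPolynomial (Fin n) ℂ) (z : Fin n → ℂ) (i : Fin n) :
    polyGrad p z (Pi.single i 1) = MvPolynomial.eval z (MvPolynomial.pderiv i p) := by
  rw [polyGrad_apply, Finset.sum_eq_single i] <;> simp +contextual

theorem polyGrad_mul {n : ℕ} (p q : MvPolynomial (Fin n) ℂ) (z : Fin n → ℂ) :
    polyGrad (p * q) z =
      MvPolynomial.eval z p • polyGrad q z + MvPolynomial.eval z q • polyGrad p z := by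
  ext v
  simp only [polyGrad_apply, MvPolynomial.pderiv_mul, map_add, map_mul,
    add_apply, smul_apply, smul_eq_mul, Finset.mul_sum,
    ← Finset.sum_add_distrib]
  exact Finset.sum_congr rfl fun i _ => by ring

theorem hasStrictFDerivAt_eval {n : ℕ} (p : MvPolynomial (Fin n) ℂ) (z : Fin n → ℂ) :
    HasStrictFDerivAt (fun y => MvPolynomial.eval y p) (polyGrad p z) z := by
  induction p using MvPolynomial.induction_on with
  | C a =>
    have : polyGrad (MvPolynomial.C a) z = 0 := by
      ext v
      simp [polyGrad_apply]
    rw [this]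
    simpa only [MvPolynomial.eval_C] using hasStrictFDerivAt_const (𝕜 := ℂ) a z
  | add p q hp hq =>
    have : polyGrad (p + q) z = polyGrad p z + polyGrad q z := by
      ext v
      simp [polyGrad_apply, add_mul, Finset.sum_add_distrib]
    rw [this]
    simpa only [map_add] using hp.fun_add hq
  | mul_X p i hp =>
    have hX : polyGrad (MvPolynomial.X i) z = ContinuousLinearMap.proj i := by
      ext v
      simp [polyGrad_apply, MvPolynomial.pderiv_X, Pi.single_apply, apply_ite, ite_mul]
    have h := hp.mul (ContinuousLinearMap.proj (R := ℂ) (φ := fun _ : Fin n => ℂ) i).hasStrictFDerivAt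
    rw [polyGrad_mul, hX]
    simpa only [map_mul, MvPolynomial.eval_X] using! h

theorem MvPolynomial.totalDegree_pderiv_lt {n : ℕ} (p : MvPolynomial (Fin n) ℂ) (i : Fin n)
    (h : pderiv i p ≠ 0) : (pderiv i p).totalDegree < p.totalDegree := by
  have key : ∀ m ∈ (pderiv i p).support, (m.sum fun _ e => e) + 1 ≤ p.totalDegree := by
    intro m hm
    rw [mem_support_iff, coeff_pderiv] at hm
    have h1 : m + Finsupp.single i 1 ∈ p.support := mem_support_iff.2 (left_ne_zero_of_mul hm)
    have h2 := le_totalDegree h1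
    rwa [Finsupp.sum_add_index' (by simp) (by simp), Finsupp.sum_single_index rfl] at h2
  obtain ⟨m, hm⟩ := Finset.nonempty_iff_ne_empty.2 (mt support_eq_empty.1 h)
  have hpos : 0 < p.totalDegree := by have := key m hm; omega
  rw [totalDegree, Finset.sup_lt_iff (by simpa using hpos)]
  intro m hm
  have := key m hm
  omega

/-- The radical of a principal ideal of polynomials is principal; by the Nullstellensatz its
generator generates the ideal of the hypersurface. -/
theorem exists_reduced_equation {n : ℕ} (P : MvPolynomial (Fin n) ℂ) (hP : P ≠ 0) :
    ∃ p : MvPolynomial (Fin n) ℂ, p ≠ 0 ∧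
      (∀ q, (∀ z ∈ charVariety P, MvPolynomial.eval z q = 0) ↔ p ∣ q) ∧ ∃ k : ℕ, P ∣ p ^ k := by
  classical
  let : StrongNormalizationMonoid (MvPolynomial (Fin n) ℂ) :=
    UniqueFactorizationMonoid.strongNormalizationMonoid
  refine ⟨UniqueFactorizationMonoid.radical P, UniqueFactorizationMonoid.radical_ne_zero,
    fun q => ?_, UniqueFactorizationMonoid.exists_dvd_radical_self_pow hP⟩
  rw [← UniqueFactorizationMonoid.exists_dvd_pow_iff_radical_dvd hP]
  have hz : charVariety P = MvPolynomial.zeroLocus ℂ (Ideal.span {P}) := by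
    ext z
    simp [charVariety, MvPolynomial.mem_zeroLocus_iff, Ideal.mem_span_singleton]
    constructor
    · rintro h _ ⟨r, rfl⟩
      simp [h]
    · exact fun h => h P dvd_rfl
  have h := MvPolynomial.vanishingIdeal_zeroLocus_eq_radical (K := ℂ) (Ideal.span {P})
  have h2 := SetLike.ext_iff.1 h q
  rw [MvPolynomial.mem_vanishingIdeal_iff, ← hz, Ideal.mem_radical_iff] at h2
  simpa [Ideal.mem_span_singleton, MvPolynomial.coe_aeval_eq_eval] using h2

/-- `p` generates the ideal of the hypersurface `{P = 0}`. -/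
def IsReducedEquation {n : ℕ} (p P : MvPolynomial (Fin n) ℂ) : Prop :=
  ∀ q, (∀ z ∈ charVariety P, MvPolynomial.eval z q = 0) ↔ p ∣ q

namespace IsReducedEquation

variable {n : ℕ} {p P : MvPolynomial (Fin n) ℂ}

theorem dvd (h : IsReducedEquation p P) : p ∣ P := (h P).1 fun _ hz => hz

theorem mem_iff (h : IsReducedEquation p P) (z : Fin n → ℂ) :
    z ∈ charVariety P ↔ MvPolynomial.eval z p = 0 := by
  refine ⟨fun hz => (h p).2 dvd_rfl z hz, fun hz => ?_⟩
  obtain ⟨r, rfl⟩ := h.dvd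
  simp [charVariety, hz]

/-- The generator alone determines the tangent space: for `q = p r` the product rule at a zero of
`p` gives `dq = r(z) dp`. -/
theorem mem_tangentSpaceAt (h : IsReducedEquation p P) {z : Fin n → ℂ} (hz : z ∈ charVariety P)
    (v : Fin n → ℂ) : v ∈ tangentSpaceAt (charVariety P) z ↔ polyGrad p z v = 0 := by
  have hmem : v ∈ tangentSpaceAt (charVariety P) z ↔
      ∀ q ∈ MvPolynomial.vanishingIdeal ℂ (charVariety P), polyGrad q z v = 0 := by
    simp only [polyGrad_apply]
    rfl
  rw [hmem]
  simp only [MvPolynomial.mem_vanishingIdeal_iff]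
  constructor
  · intro hv
    exact hv p ((h p).2 dvd_rfl)
  · intro hv q hq
    obtain ⟨r, rfl⟩ := (h q).1 hq
    rw [polyGrad_mul, (h.mem_iff z).1 hz]
    simp [hv]

theorem tangentSpaceAt_eq (h : IsReducedEquation p P) {z : Fin n → ℂ} (hz : z ∈ charVariety P) :
    tangentSpaceAt (charVariety P) z = LinearMap.ker (polyGrad p z : (Fin n → ℂ) →ₗ[ℂ] ℂ) := by
  ext v
  simp [h.mem_tangentSpaceAt hz]

/-- The tangent space is `ker dp`, which by rank–nullity has codimension one exactly when `dp ≠ 0`.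
-/
theorem isRegularPoint_iff (h : IsReducedEquation p P) (z : Fin n → ℂ) :
    IsRegularPoint (charVariety P) z ↔ z ∈ charVariety P ∧ polyGrad p z ≠ 0 := by
  refine and_congr_right fun hz => ?_
  rw [h.tangentSpaceAt_eq hz]
  have hrn := LinearMap.finrank_range_add_finrank_ker (polyGrad p z : (Fin n → ℂ) →ₗ[ℂ] ℂ)
  rw [Module.finrank_fin_fun] at hrn
  constructor
  · intro hk h0
    have h1 : LinearMap.range (polyGrad p z : (Fin n → ℂ) →ₗ[ℂ] ℂ) = ⊥ := by
      rw [h0]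
      exact LinearMap.range_zero
    rw [h1, finrank_bot] at hrn
    omega
  · intro h0
    have hr : LinearMap.range (polyGrad p z : (Fin n → ℂ) →ₗ[ℂ] ℂ) = ⊤ := by
      refine LinearMap.range_eq_top.2 (LinearMap.surjective ?_)
      exact fun h' => h0 (ContinuousLinearMap.coe_injective h')
    rw [hr, finrank_top, Module.finrank_self] at hrn
    omega

/-- A combination of partial derivatives that vanishes on the hypersurface vanishes, by degree. -/
theorem eq_zero_of_lower_degree (h : IsReducedEquation p P) (hp : 1 ≤ p.totalDegree)
    (a b : ℂ) (i j : Fin n)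
    (hv : ∀ z ∈ charVariety P,
      a * MvPolynomial.eval z (MvPolynomial.pderiv i p) -
        b * MvPolynomial.eval z (MvPolynomial.pderiv j p) = 0) (z : Fin n → ℂ) :
    a * MvPolynomial.eval z (MvPolynomial.pderiv i p) =
      b * MvPolynomial.eval z (MvPolynomial.pderiv j p) := by
  set q := a • MvPolynomial.pderiv i p - b • MvPolynomial.pderiv j p with hq
  have hqz : ∀ z, MvPolynomial.eval z q =
      a * MvPolynomial.eval z (MvPolynomial.pderiv i p) -
        b * MvPolynomial.eval z (MvPolynomial.pderiv j p) := fun z => by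
    simp [hq, MvPolynomial.smul_eval]
  have hdvd : p ∣ q := (h q).1 fun z hz => by rw [hqz, hv z hz]
  have hdeg : ∀ (c : ℂ) (k : Fin n), (c • MvPolynomial.pderiv k p).totalDegree < p.totalDegree := by
    intro c k
    refine (MvPolynomial.totalDegree_smul_le c _).trans_lt ?_
    by_cases h0 : MvPolynomial.pderiv k p = 0
    · rw [h0, MvPolynomial.totalDegree_zero]; omega
    · exact MvPolynomial.totalDegree_pderiv_lt p k h0
  have hqdeg : q.totalDegree < p.totalDegree := by
    rw [hq]
    exact (MvPolynomial.totalDegree_sub _ _).trans_lt (max_lt (hdeg a i) (hdeg b j))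
  -- A nonzero multiple of `p` has at least the degree of `p`.
  have hq0 : q = 0 := by
    by_contra hq0
    obtain ⟨r, hr⟩ := hdvd
    have hp0 : p ≠ 0 := by rintro rfl; simp at hp
    have hr0 : r ≠ 0 := by rintro rfl; simp at hr; exact hq0 hr
    rw [hr, MvPolynomial.totalDegree_mul_of_isDomain hp0 hr0] at hqdeg
    omega
  have := hqz z
  rw [hq0, map_zero] at this
  exact (sub_eq_zero.1 this.symm)

end IsReducedEquation

/-! ### Kernels of linear functionals -/

section Functionals

variable {E : Type*} [NormedAddCommGroup E] [NormedSpace ℂ E]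

theorem exists_smul_eq_of_ker_le {α β : E →L[ℂ] ℂ} (hβ : β ≠ 0)
    (h : ∀ x, β x = 0 → α x = 0) : ∃ t : ℂ, α = t • β := by
  obtain ⟨u, hu⟩ : ∃ u, β u ≠ 0 := by
    by_contra! hc
    exact hβ (ContinuousLinearMap.ext hc)
  refine ⟨α u / β u, ContinuousLinearMap.ext fun x => ?_⟩
  have h1 := h (x - (β x / β u) • u) (by simp [hu])
  rw [map_sub, map_smul, sub_eq_zero, smul_eq_mul] at h1
  rw [h1, smul_apply, smul_eq_mul]
  field_simp

/-- A vector of `ker β` outside `ker α` spans a complement of `ker α`, so the two kernels would fill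
the space. Hence `ker β` lies in `ker α`. -/
theorem exists_smul_eq_of_ker_sup_ne_top {α β : E →L[ℂ] ℂ} (hβ : β ≠ 0)
    (h : LinearMap.ker (α : E →ₗ[ℂ] ℂ) ⊔ LinearMap.ker (β : E →ₗ[ℂ] ℂ) ≠ ⊤) :
    ∃ t : ℂ, α = t • β := by
  refine exists_smul_eq_of_ker_le hβ fun v hv => ?_
  by_contra hα
  refine h (eq_top_iff.2 fun x _ => ?_)
  have hx : x = (x - (α x / α v) • v) + (α x / α v) • v := by abel
  rw [hx]
  refine Submodule.add_mem_sup ?_ (Submodule.smul_mem _ _ ?_)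
  · simp [hα]
  · simpa using hv

theorem exists_dual_of_ker_sup_eq_top {α β : E →L[ℂ] ℂ} (hα : α ≠ 0)
    (h : LinearMap.ker (α : E →ₗ[ℂ] ℂ) ⊔ LinearMap.ker (β : E →ₗ[ℂ] ℂ) = ⊤) :
    ∃ v, α v = 1 ∧ β v = 0 := by
  obtain ⟨u, hu⟩ : ∃ u, α u ≠ 0 := by
    by_contra! hc
    exact hα (ContinuousLinearMap.ext hc)
  obtain ⟨y, hy, z, hz, hyz⟩ := Submodule.mem_sup.1 (h ▸ Submodule.mem_top : u ∈ _ ⊔ _)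
  have hy' : α y = 0 := by simpa using hy
  have hz' : β z = 0 := by simpa using hz
  have hzu : α z = α u := by rw [← hyz, map_add, hy', zero_add]
  refine ⟨(α u)⁻¹ • z, ?_, ?_⟩
  · simp [hzu, hu]
  · simp [hz']

end Functionals

/-! ### Parallel and transversal varieties -/

variable {n : ℕ}

theorem differentiable_eval_line (p : MvPolynomial (Fin n) ℂ) (z v : Fin n → ℂ) :
    Differentiable ℂ fun t : ℂ => MvPolynomial.eval (z + t • v) p := by
  have h : Differentiable ℂ fun y => MvPolynomial.eval y p := fun y =>
    (hasStrictFDerivAt_eval p y).differentiableAt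
  exact h.comp (by fun_prop : Differentiable ℂ fun t : ℂ => z + t • v)

theorem eval_add_of_polyGrad_eq_zero (p : MvPolynomial (Fin n) ℂ) (v : Fin n → ℂ)
    (h : ∀ z, polyGrad p z v = 0) (z : Fin n → ℂ) :
    MvPolynomial.eval (z + v) p = MvPolynomial.eval z p := by
  have h1 := is_const_of_deriv_eq_zero (differentiable_eval_line p z v) (fun t => by
    have := ((hasStrictFDerivAt_eval p (z + t • v)).hasFDerivAt.comp_hasDerivAt t
      (((hasDerivAt_id t).smul_const v).const_add z)).deriv
    refine this.trans ?_
    simp [h]) 1 0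
  simpa using h1

/-- The one-variable identity theorem, applied on the complex line joining `z₀` to an arbitrary
point. -/
theorem MvPolynomial.eq_zero_of_eventually_eval_eq_zero (p : MvPolynomial (Fin n) ℂ)
    (z₀ : Fin n → ℂ) (h : ∀ᶠ z in nhds z₀, eval z p = 0) : p = 0 := by
  refine MvPolynomial.funext fun z => ?_
  have hd := differentiable_eval_line p z₀ (z - z₀)
  have ha : AnalyticOnNhd ℂ (fun t : ℂ => eval (z₀ + t • (z - z₀)) p) Set.univ :=
    fun t _ => hd.analyticAt t
  have hc : Filter.Tendsto (fun t : ℂ => z₀ + t • (z - z₀)) (nhds 0) (nhds z₀) := by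
    have : Continuous fun t : ℂ => z₀ + t • (z - z₀) := by fun_prop
    simpa using this.tendsto 0
  have h0 := ha.eqOn_zero_of_preconnected_of_eventuallyEq_zero isPreconnected_univ
    (Set.mem_univ 0) (hc.eventually h) (Set.mem_univ 1)
  simpa using h0

/-- Since `P` divides a power of `p`, a constant `p` would force `P` to be constant. -/
theorem exists_isReducedEquation (P : MvPolynomial (Fin n) ℂ) (hP : 1 ≤ P.totalDegree) :
    ∃ p, IsReducedEquation p P ∧ 1 ≤ p.totalDegree ∧ ∃ k : ℕ, P ∣ p ^ k := by
  obtain ⟨p, hp0, hp, k, hk⟩ := exists_reduced_equation P (by rintro rfl; simp at hP)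
  refine ⟨p, hp, ?_, k, hk⟩
  by_contra hlt
  obtain ⟨r, hr⟩ := hk
  have hr0 : P * r ≠ 0 := hr ▸ pow_ne_zero k hp0
  have h1 := MvPolynomial.totalDegree_pow p k
  rw [hr, MvPolynomial.totalDegree_mul_of_isDomain (left_ne_zero_of_mul hr0)
    (right_ne_zero_of_mul hr0), show p.totalDegree = 0 by omega] at h1
  omega

namespace IsReducedEquation

variable {p P : MvPolynomial (Fin n) ℂ}

/-- If `dp` vanished on the whole variety, each partial derivative would vanish identically for
degree reasons, and `p` would be constant. -/
theorem exists_regular (h : IsReducedEquation p P) (hp : 1 ≤ p.totalDegree) :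
    ∃ z ∈ charVariety P, polyGrad p z ≠ 0 := by
  by_contra! hc
  have h1 : ∀ i z, MvPolynomial.eval z (MvPolynomial.pderiv i p) = 0 := fun i z => by
    simpa using h.eq_zero_of_lower_degree hp 1 0 i i (fun z hz => by
      simp [← polyGrad_single, hc z hz]) z
  have h2 : p = MvPolynomial.C (MvPolynomial.eval 0 p) := by
    refine MvPolynomial.funext fun z => ?_
    have := eval_add_of_polyGrad_eq_zero p z (fun y => by simp [polyGrad_apply, h1]) 0
    simpa using this
  rw [h2, MvPolynomial.totalDegree_C] at hp
  omega

/-- Proportionality of `dp` to `γ` on the variety is the vanishing there of minors of degree below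
that of `p`. It therefore holds on all of `ℂⁿ`, and `p` has zero derivative along `ker γ`. -/
theorem eval_add_of_parallel (h : IsReducedEquation p P) (hp : 1 ≤ p.totalDegree)
    {γ : (Fin n → ℂ) →L[ℂ] ℂ} (hγ : γ ≠ 0)
    (hpar : ∀ z ∈ charVariety P, ∃ t : ℂ, polyGrad p z = t • γ) (v : Fin n → ℂ) (hv : γ v = 0)
    (z : Fin n → ℂ) : MvPolynomial.eval (z + v) p = MvPolynomial.eval z p := by
  refine eval_add_of_polyGrad_eq_zero p v (fun y => ?_) z
  have hγs : ∀ x, γ x = ∑ i, γ (Pi.single i 1) * x i := fun x => by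
    conv_lhs => rw [pi_eq_sum_univ' x]
    simp [map_sum, mul_comm]
  obtain ⟨k, hk⟩ : ∃ k, γ (Pi.single k 1) ≠ 0 := by
    by_contra! hc
    exact hγ (ContinuousLinearMap.ext fun x => by simp [hγs x, hc])
  have key : ∀ i, γ (Pi.single k 1) * MvPolynomial.eval y (MvPolynomial.pderiv i p) =
      γ (Pi.single i 1) * MvPolynomial.eval y (MvPolynomial.pderiv k p) := fun i => by
    refine h.eq_zero_of_lower_degree hp _ _ i k (fun z hz => ?_) y
    obtain ⟨t, ht⟩ := hpar z hz
    rw [← polyGrad_single, ← polyGrad_single, ht]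
    simp only [smul_apply, smul_eq_mul]
    ring
  have h2 : γ (Pi.single k 1) * polyGrad p y v = 0 := by
    rw [polyGrad_apply, Finset.mul_sum]
    have : γ v * MvPolynomial.eval y (MvPolynomial.pderiv k p) = 0 := by rw [hv, zero_mul]
    rw [hγs, Finset.sum_mul] at this
    rw [← this]
    refine Finset.sum_congr rfl fun i _ => ?_
    rw [← mul_assoc, key i]
    ring
  exact (mul_eq_zero.1 h2).resolve_left hk

end IsReducedEquation

/-- The linear polynomial `∑ c_i X_i`. -/
noncomputable def linPoly (c : Fin n → ℂ) : MvPolynomial (Fin n) ℂ :=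
  ∑ i, MvPolynomial.C (c i) * MvPolynomial.X i

@[simp] theorem eval_linPoly (c z : Fin n → ℂ) :
    MvPolynomial.eval z (linPoly c) = ∑ i, c i * z i := by
  simp [linPoly]

/-- A polynomial invariant under translation by the vectors orthogonal to `c` is a polynomial in
`c · z`, hence all its powers divide products of affine functions `c · z - s`. -/
theorem exists_dvd_prod_of_invariant {c : Fin n → ℂ} (hc : c ≠ 0) {p : MvPolynomial (Fin n) ℂ}
    (hp0 : p ≠ 0)
    (h : ∀ v, ∑ i, c i * v i = 0 → ∀ z, MvPolynomial.eval (z + v) p = MvPolynomial.eval z p)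
    (k : ℕ) : ∃ S : List ℂ, p ^ k ∣ (S.map fun s => linPoly c - MvPolynomial.C s).prod := by
  obtain ⟨d, hd⟩ : ∃ d : Fin n → ℂ, ∑ i, c i * d i = 1 := by
    obtain ⟨j, hj⟩ := Function.ne_iff.1 hc
    refine ⟨Pi.single j (c j)⁻¹, ?_⟩
    rw [Finset.sum_eq_single j]
    · simpa using mul_inv_cancel₀ hj
    · intro i _ hij
      simp [hij]
    · simp
  -- The restriction of `p` to the line `ℂ d`. As `z - (c · z) d` is orthogonal to `c`, invariance
  -- gives `p(z) = q(c · z)`.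
  set q : Polynomial ℂ := MvPolynomial.aeval (fun i => Polynomial.C (d i) * Polynomial.X) p with hq
  have hpq : p = Polynomial.aeval (linPoly c) q := by
    refine MvPolynomial.funext fun z => ?_
    have h1 : MvPolynomial.eval z (Polynomial.aeval (linPoly c) q) =
        Polynomial.eval (∑ i, c i * z i) q := by
      have := Polynomial.hom_eval₂ q (algebraMap ℂ (MvPolynomial (Fin n) ℂ))
        (MvPolynomial.eval z) (linPoly c)
      rw [Polynomial.aeval_def, this, eval_linPoly, Polynomial.eval]
      congr 1
      ext x
      simp
    have h2 : ∀ t : ℂ, Polynomial.eval t q = MvPolynomial.eval (t • d) p := fun t => by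
      rw [hq, MvPolynomial.aeval_def, ← Polynomial.coe_evalRingHom, MvPolynomial.hom_eval₂]
      rw [MvPolynomial.eval, MvPolynomial.coe_eval₂Hom]
      congr 1
      · ext x
        simp
      · ext i
        simp only [Polynomial.coe_evalRingHom, Polynomial.eval_mul,
          Polynomial.eval_C, Polynomial.eval_X, Pi.smul_apply, smul_eq_mul]
        ring
    rw [h1, h2]
    have := h (z - (∑ i, c i * z i) • d) (by
      simp only [Pi.sub_apply, Pi.smul_apply, smul_eq_mul, mul_sub, Finset.sum_sub_distrib]
      have : ∀ i, c i * ((∑ i, c i * z i) * d i) = (∑ i, c i * z i) * (c i * d i) :=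
        fun i => by ring
      simp only [this, ← Finset.mul_sum, hd]
      ring) ((∑ i, c i * z i) • d)
    simpa using this
  have hq0 : q ^ k ≠ 0 := pow_ne_zero _ (by
    rintro h0
    rw [h0, map_zero] at hpq
    exact hp0 hpq)
  -- Over `ℂ` the polynomial `q ^ k` splits. Its leading coefficient is a unit and its roots, with
  -- multiplicity, are the required `s`.
  refine ⟨(q ^ k).roots.toList, ?_⟩
  have hspl := (IsAlgClosed.splits (q ^ k)).eq_prod_roots
  rw [hpq, ← map_pow]
  nth_rw 1 [hspl]
  rw [map_mul]
  have hu : IsUnit (Polynomial.aeval (linPoly c) (Polynomial.C (q ^ k).leadingCoeff)) :=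
    ((Polynomial.isUnit_C.2 (isUnit_iff_ne_zero.2
      (Polynomial.leadingCoeff_ne_zero.2 hq0)))).map _
  rw [hu.mul_left_dvd]
  refine dvd_of_eq ?_
  nth_rw 1 [← Multiset.coe_toList (q ^ k).roots]
  rw [Multiset.map_coe, Multiset.prod_coe, map_list_prod,
    List.map_map]
  refine congrArg List.prod (List.map_congr_left fun s _ => ?_)
  simp only [Function.comp, map_sub, Polynomial.aeval_X, Polynomial.aeval_C,
    MvPolynomial.algebraMap_eq]

/-- All gradients on both varieties are multiples of one `γ`, so both reduced equations are
invariant along `ker γ`. The divisibilities turn both operators into factors of products of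
first-order operators along `c`; the translation invariance of the union gives the hyperplanes of
part (b). -/
theorem exists_list_of_not_transversal (P₁ P₂ : MvPolynomial (Fin n) ℂ)
    (hP₁ : 1 ≤ P₁.totalDegree) (hP₂ : 1 ≤ P₂.totalDegree)
    (hT : ¬ VarietiesTransversal (charVariety P₁) (charVariety P₂)) :
    ∃ c : Fin n → ℂ, c ≠ 0 ∧
      (∃ S : List ℂ, P₁ ∣ (S.map fun s => linPoly c - MvPolynomial.C s).prod) ∧
      (∃ S : List ℂ, P₂ ∣ (S.map fun s => linPoly c - MvPolynomial.C s).prod) ∧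
      ∀ v, ∑ i, c i * v i = 0 → ∀ z ∈ charVariety P₁ ∪ charVariety P₂,
        z + v ∈ charVariety P₁ ∪ charVariety P₂ := by
  obtain ⟨p₁, h₁, hd₁, k₁, hk₁⟩ := exists_isReducedEquation P₁ hP₁
  obtain ⟨p₂, h₂, hd₂, k₂, hk₂⟩ := exists_isReducedEquation P₂ hP₂
  obtain ⟨z₁, hz₁, hg₁⟩ := h₁.exists_regular hd₁
  obtain ⟨z₂, hz₂, hg₂⟩ := h₂.exists_regular hd₂
  set γ := polyGrad p₁ z₁ with hγ
  have hpar : ∀ y₁ ∈ charVariety P₁, ∀ y₂ ∈ charVariety P₂, polyGrad p₁ y₁ ≠ 0 →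
      polyGrad p₂ y₂ ≠ 0 → LinearMap.ker (polyGrad p₁ y₁ : (Fin n → ℂ) →ₗ[ℂ] ℂ) ⊔
        LinearMap.ker (polyGrad p₂ y₂ : (Fin n → ℂ) →ₗ[ℂ] ℂ) ≠ ⊤ := by
    intro y₁ hy₁ y₂ hy₂ hn₁ hn₂ htop
    refine hT ⟨y₁, y₂, (h₁.isRegularPoint_iff _).2 ⟨hy₁, hn₁⟩,
      (h₂.isRegularPoint_iff _).2 ⟨hy₂, hn₂⟩, ?_⟩
    rw [h₁.tangentSpaceAt_eq hy₁, h₂.tangentSpaceAt_eq hy₂, htop]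
  have hpar₂ : ∀ z ∈ charVariety P₂, ∃ t : ℂ, polyGrad p₂ z = t • γ := by
    intro z hz
    by_cases h0 : polyGrad p₂ z = 0
    · exact ⟨0, by ext v; simp [h0]⟩
    · exact exists_smul_eq_of_ker_sup_ne_top hg₁ (by
        rw [sup_comm]
        exact hpar z₁ hz₁ z hz hg₁ h0)
  -- Transversality only compares points of different varieties, so two gradients of `p₁` are
  -- compared through the gradient of `p₂` at `z₂`.
  have hpar₁ : ∀ z ∈ charVariety P₁, ∃ t : ℂ, polyGrad p₁ z = t • γ := by
    intro z hz
    by_cases h0 : polyGrad p₁ z = 0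
    · exact ⟨0, by ext v; simp [h0]⟩
    · obtain ⟨t, ht⟩ := exists_smul_eq_of_ker_sup_ne_top hg₂ (hpar z hz z₂ hz₂ h0 hg₂)
      obtain ⟨s, hs⟩ := hpar₂ z₂ hz₂
      exact ⟨t * s, by rw [ht, hs, smul_smul]⟩
  have hγs : ∀ x, ∑ i, γ (Pi.single i 1) * x i = γ x := fun x => by
    conv_rhs => rw [pi_eq_sum_univ' x]
    simp [map_sum, mul_comm]
  have hc : (fun i => γ (Pi.single i 1)) ≠ 0 := by
    intro h0
    refine hg₁ (ContinuousLinearMap.ext fun x => ?_)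
    rw [← hγs]
    simp [funext_iff] at h0
    simp [h0]
  have hp₁ : p₁ ≠ 0 := by rintro rfl; simp at hd₁
  have hp₂ : p₂ ≠ 0 := by rintro rfl; simp at hd₂
  have inv₁ := h₁.eval_add_of_parallel hd₁ hg₁ hpar₁
  have inv₂ := h₂.eval_add_of_parallel hd₂ hg₁ hpar₂
  refine ⟨fun i => γ (Pi.single i 1), hc, ?_, ?_, ?_⟩
  · obtain ⟨S, hS⟩ := exists_dvd_prod_of_invariant hc hp₁
      (fun v hv => inv₁ v (by rw [← hγs, hv])) k₁
    exact ⟨S, hk₁.trans hS⟩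
  · obtain ⟨S, hS⟩ := exists_dvd_prod_of_invariant hc hp₂
      (fun v hv => inv₂ v (by rw [← hγs, hv])) k₂
    exact ⟨S, hk₂.trans hS⟩
  · intro v hv z hz
    have hv' : γ v = 0 := by rw [← hγs, hv]
    simp only [Set.mem_union, h₁.mem_iff, h₂.mem_iff, inv₁ v hv', inv₂ v hv'] at hz ⊢
    exact hz

theorem isUnionOfParallelHyperplanes_of_not_transversal (P₁ P₂ : MvPolynomial (Fin n) ℂ)
    (hP₁ : 1 ≤ P₁.totalDegree) (hP₂ : 1 ≤ P₂.totalDegree)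
    (hT : ¬ VarietiesTransversal (charVariety P₁) (charVariety P₂)) :
    IsUnionOfParallelHyperplanes (charVariety P₁ ∪ charVariety P₂) := by
  obtain ⟨c, hc, -, -, hinv⟩ := exists_list_of_not_transversal P₁ P₂ hP₁ hP₂ hT
  refine ⟨c, hc, (fun z => ∑ i, c i * z i) '' (charVariety P₁ ∪ charVariety P₂), ?_⟩
  ext z
  simp only [Set.mem_iUnion, Set.mem_ofPred_eq, exists_prop]
  constructor
  · exact fun hz => ⟨_, ⟨z, hz, rfl⟩, rfl⟩
  · rintro ⟨_, ⟨y, hy, rfl⟩, hyz⟩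
    have := hinv (z - y) (by
      simp only [Pi.sub_apply, mul_sub, Finset.sum_sub_distrib]
      simpa [sub_eq_zero] using hyz) y hy
    simpa using this

/-- It suffices that every nonzero gradient of `p₁` or `p₂` at a zero is a multiple of the common
normal `γ`: the kernels then coincide and cannot span. -/
theorem not_transversal_of_isUnionOfParallelHyperplanes (P₁ P₂ : MvPolynomial (Fin n) ℂ)
    (hP₁ : 1 ≤ P₁.totalDegree) (hP₂ : 1 ≤ P₂.totalDegree)
    (hV : IsUnionOfParallelHyperplanes (charVariety P₁ ∪ charVariety P₂)) :
    ¬ VarietiesTransversal (charVariety P₁) (charVariety P₂) := by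
  obtain ⟨p₁, h₁, -, -⟩ := exists_isReducedEquation P₁ hP₁
  obtain ⟨p₂, h₂, -, -⟩ := exists_isReducedEquation P₂ hP₂
  obtain ⟨c, hc, S, hS⟩ := hV
  set γ : (Fin n → ℂ) →L[ℂ] ℂ := ∑ i, c i • ContinuousLinearMap.proj i with hγ
  have hγs : ∀ x, γ x = ∑ i, c i * x i := fun x => by simp [hγ]
  have hγ0 : γ ≠ 0 := by
    obtain ⟨j, hj⟩ := Function.ne_iff.1 hc
    intro h0
    refine hj ?_
    have := hγs (Pi.single j 1)
    rw [h0, Finset.sum_eq_single j (by simp +contextual) (by simp)] at this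
    simpa using this.symm
  have hP : P₁ * P₂ ≠ 0 := mul_ne_zero (by rintro rfl; simp at hP₁) (by rintro rfl; simp at hP₂)
  have key : ∀ p : MvPolynomial (Fin n) ℂ,
      (∀ y, MvPolynomial.eval y p = 0 → y ∈ charVariety P₁ ∪ charVariety P₂) →
      ∀ z, MvPolynomial.eval z p = 0 → polyGrad p z ≠ 0 → ∃ t : ℂ, polyGrad p z = t • γ := by
    intro p hp z hz hg
    refine exists_smul_eq_of_ker_sup_ne_top hγ0 fun htop => hP ?_
    obtain ⟨u, hu₁, hu₂⟩ := exists_dual_of_ker_sup_eq_top hg htop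
    obtain ⟨w, hw₁, hw₂⟩ := exists_dual_of_ker_sup_eq_top hγ0 (by rwa [sup_comm])
    have hf : HasStrictFDerivAt (fun y => (MvPolynomial.eval y p, γ y))
        ((polyGrad p z).prod γ) z :=
      (hasStrictFDerivAt_eval p z).prodMk γ.hasStrictFDerivAt
    have hsurj : ((polyGrad p z).prod γ).range = ⊤ := by
      refine LinearMap.range_eq_top.2 fun ab => ⟨ab.1 • u + ab.2 • w, ?_⟩
      ext <;> simp [hu₁, hu₂, hw₁, hw₂]
    have hnhds := hf.map_nhds_eq_of_surj hsurj
    -- The map `(p, γ)` is a submersion at `z`, so it is onto a neighbourhood of `(0, γ z)`: for `y`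
    -- near `z` some zero `x` of `p` has `γ x = γ y`. The hyperplane through `x`, and with it `y`,
    -- then lies in the union, so `P₁ P₂` vanishes near `z`.
    have hev : ∀ᶠ ab in nhds (MvPolynomial.eval z p, γ z),
        ∃ y, (MvPolynomial.eval y p, γ y) = ab := by
      rw [← hnhds, Filter.eventually_map]
      exact Filter.Eventually.of_forall fun y => ⟨y, rfl⟩
    have hcont : Filter.Tendsto (fun y => ((0 : ℂ), γ y)) (nhds z)
        (nhds (MvPolynomial.eval z p, γ z)) := by
      rw [hz]
      exact (by fun_prop : Continuous fun y => ((0 : ℂ), γ y)).tendsto z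
    refine MvPolynomial.eq_zero_of_eventually_eval_eq_zero _ z ?_
    filter_upwards [hcont.eventually hev] with y ⟨x, hx⟩
    rw [Prod.mk.injEq] at hx
    have hxV := hp x hx.1
    rw [hS] at hxV
    simp only [Set.mem_iUnion, Set.mem_ofPred_eq, exists_prop] at hxV
    obtain ⟨s, hs, hxs⟩ := hxV
    have hyV : y ∈ charVariety P₁ ∪ charVariety P₂ := by
      rw [hS]
      simp only [Set.mem_iUnion, Set.mem_ofPred_eq, exists_prop]
      exact ⟨s, hs, by rw [← hxs, ← hγs, ← hγs, hx.2]⟩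
    simpa [charVariety] using hyV
  rintro ⟨z₁, z₂, hr₁, hr₂, htop⟩
  obtain ⟨hz₁, hg₁⟩ := (h₁.isRegularPoint_iff _).1 hr₁
  obtain ⟨hz₂, hg₂⟩ := (h₂.isRegularPoint_iff _).1 hr₂
  rw [h₁.tangentSpaceAt_eq hz₁, h₂.tangentSpaceAt_eq hz₂] at htop
  obtain ⟨t₁, ht₁⟩ := key p₁ (fun y hy => Or.inl ((h₁.mem_iff y).2 hy)) z₁
    ((h₁.mem_iff _).1 hz₁) hg₁
  obtain ⟨t₂, ht₂⟩ := key p₂ (fun y hy => Or.inr ((h₂.mem_iff y).2 hy)) z₂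
    ((h₂.mem_iff _).1 hz₂) hg₂
  obtain ⟨v, hv₁, hv₂⟩ := exists_dual_of_ker_sup_eq_top hg₁ htop
  have hz : γ v = 0 := by
    have ht : t₂ ≠ 0 := by
      rintro rfl
      exact hg₂ (by ext v; simp [ht₂])
    rw [ht₂] at hv₂
    simpa [ht] using hv₂
  rw [ht₁] at hv₁
  simp [hz] at hv₁

/-- If the varieties are transversal, their sum set contains an open set. -/
theorem eventually_mem_add_of_transversal (P₁ P₂ : MvPolynomial (Fin n) ℂ)
    (hP₁ : 1 ≤ P₁.totalDegree) (hP₂ : 1 ≤ P₂.totalDegree)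
    (hT : VarietiesTransversal (charVariety P₁) (charVariety P₂)) :
    ∃ z₀ : Fin n → ℂ, ∀ᶠ z in nhds z₀,
      ∃ z₁ ∈ charVariety P₁, ∃ z₂ ∈ charVariety P₂, z = z₁ + z₂ := by
  obtain ⟨p₁, h₁, -, -⟩ := exists_isReducedEquation P₁ hP₁
  obtain ⟨p₂, h₂, -, -⟩ := exists_isReducedEquation P₂ hP₂
  obtain ⟨z₁, z₂, hr₁, hr₂, htop⟩ := hT
  obtain ⟨hz₁, hg₁⟩ := (h₁.isRegularPoint_iff _).1 hr₁
  obtain ⟨hz₂, hg₂⟩ := (h₂.isRegularPoint_iff _).1 hr₂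
  rw [h₁.tangentSpaceAt_eq hz₁, h₂.tangentSpaceAt_eq hz₂] at htop
  obtain ⟨u, hu₁, hu₂⟩ := exists_dual_of_ker_sup_eq_top hg₁ htop
  obtain ⟨w, hw₁, hw₂⟩ := exists_dual_of_ker_sup_eq_top hg₂ (by rwa [sup_comm])
  let F := Fin n → ℂ
  have hf₁ : HasStrictFDerivAt (fun y : F × F => MvPolynomial.eval y.1 p₁)
      ((polyGrad p₁ z₁).comp (ContinuousLinearMap.fst ℂ F F)) (z₁, z₂) :=
    HasStrictFDerivAt.comp (g := fun y => MvPolynomial.eval y p₁) (z₁, z₂)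
      (hasStrictFDerivAt_eval p₁ z₁) hasStrictFDerivAt_fst
  have hf₂ : HasStrictFDerivAt (fun y : F × F => MvPolynomial.eval y.2 p₂)
      ((polyGrad p₂ z₂).comp (ContinuousLinearMap.snd ℂ F F)) (z₁, z₂) :=
    HasStrictFDerivAt.comp (g := fun y => MvPolynomial.eval y p₂) (z₁, z₂)
      (hasStrictFDerivAt_eval p₂ z₂) hasStrictFDerivAt_snd
  have hf : HasStrictFDerivAt
      (fun y : F × F => (MvPolynomial.eval y.1 p₁, MvPolynomial.eval y.2 p₂, y.1 + y.2))
      (((polyGrad p₁ z₁).comp (ContinuousLinearMap.fst ℂ F F)).prod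
        (((polyGrad p₂ z₂).comp (ContinuousLinearMap.snd ℂ F F)).prod
          (ContinuousLinearMap.fst ℂ F F + ContinuousLinearMap.snd ℂ F F))) (z₁, z₂) :=
    hf₁.prodMk (hf₂.prodMk (hasStrictFDerivAt_fst.add hasStrictFDerivAt_snd))
  have hsurj := hf.map_nhds_eq_of_surj (by
    refine LinearMap.range_eq_top.2 fun abx => ?_
    obtain ⟨a, b, x⟩ := abx
    -- The vectors `u` and `w` are dual to `dp₁`, `dp₂`. The two components must add up to `x`, and
    -- the second must have `dp₂`-value `b`, which fixes the coefficient of `w` in the first.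
    refine ⟨(a • u + (polyGrad p₂ z₂ x - b) • w, x - (a • u + (polyGrad p₂ z₂ x - b) • w)), ?_⟩
    simp [hu₁, hu₂, hw₁, hw₂])
  refine ⟨z₁ + z₂, ?_⟩
  have hev : ∀ᶠ abx in nhds (MvPolynomial.eval z₁ p₁, MvPolynomial.eval z₂ p₂, z₁ + z₂),
      ∃ y : F × F, (MvPolynomial.eval y.1 p₁, MvPolynomial.eval y.2 p₂, y.1 + y.2) = abx := by
    refine Filter.Eventually.filter_mono hsurj.ge ?_
    rw [Filter.eventually_map]
    exact Filter.Eventually.of_forall fun y => ⟨y, rfl⟩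
  have hcont : Filter.Tendsto (fun y : F => ((0 : ℂ), (0 : ℂ), y)) (nhds (z₁ + z₂))
      (nhds (MvPolynomial.eval z₁ p₁, MvPolynomial.eval z₂ p₂, z₁ + z₂)) := by
    rw [(h₁.mem_iff _).1 hz₁, (h₂.mem_iff _).1 hz₂]
    exact (by fun_prop : Continuous fun y : F => ((0 : ℂ), (0 : ℂ), y)).tendsto _
  filter_upwards [hcont.eventually hev] with y ⟨x, hx⟩
  simp only [Prod.mk.injEq] at hx
  exact ⟨x.1, (h₁.mem_iff _).2 hx.1, x.2, (h₂.mem_iff _).2 hx.2.1, hx.2.2.symm⟩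

/-! ### Transposed operators and exponential solutions -/

section TransposeOp

variable {n : ℕ}

theorem contDiff_fderiv_apply_const {E F : Type*} [NormedAddCommGroup E] [NormedSpace ℝ E]
    [NormedAddCommGroup F] [NormedSpace ℝ F] {f : E → F} (hf : ContDiff ℝ ∞ f) (a : E) :
    ContDiff ℝ ∞ fun x => fderiv ℝ f x a :=
  (hf.fderiv_right (m := ∞) (by simp)).clm_apply contDiff_const

theorem fderiv_fderiv_apply_comm {E F : Type*} [NormedAddCommGroup E] [NormedSpace ℝ E]
    [NormedAddCommGroup F] [NormedSpace ℝ F] {f : E → F} (hf : ContDiff ℝ ∞ f) (a b x : E) :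
    fderiv ℝ (fun y => fderiv ℝ f y a) x b = fderiv ℝ (fun y => fderiv ℝ f y b) x a := by
  have hd : DifferentiableAt ℝ (fderiv ℝ f) x :=
    ((hf.fderiv_right (m := ∞) (by simp)).differentiable (by simp)).differentiableAt
  have h : ∀ c, fderiv ℝ (fun y => fderiv ℝ f y c) x = (fderiv ℝ (fderiv ℝ f) x).flip c := by
    intro c
    rw [fderiv_clm_apply hd (differentiableAt_const c)]
    simp
  rw [h, h]
  exact (hf.contDiffAt.isSymmSndFDerivAt
    (by simpa using WithTop.coe_le_coe.2 (le_top : (2 : ℕ∞) ≤ ⊤))).eq b a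

theorem contDiff_partialDeriv {u : (Fin n → ℝ) → ℂ} (hu : ContDiff ℝ ∞ u) (i : Fin n) :
    ContDiff ℝ ∞ (partialDeriv i u) :=
  contDiff_fderiv_apply_const hu _

theorem contDiff_iterate_partialDeriv {u : (Fin n → ℝ) → ℂ} (hu : ContDiff ℝ ∞ u) (i : Fin n)
    (k : ℕ) : ContDiff ℝ ∞ ((partialDeriv i)^[k] u) := by
  induction k with
  | zero => simpa using hu
  | succ k ih => rw [Function.iterate_succ_apply']; exact contDiff_partialDeriv ih i

theorem contDiff_foldr_partialDeriv {u : (Fin n → ℝ) → ℂ} (hu : ContDiff ℝ ∞ u)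
    (j : Fin n →₀ ℕ) (l : List (Fin n)) :
    ContDiff ℝ ∞ (l.foldr (fun i v => (partialDeriv i)^[j i] v) u) := by
  induction l with
  | nil => simpa using hu
  | cons k l ih => exact contDiff_iterate_partialDeriv ih k _

theorem contDiff_multiDeriv {u : (Fin n → ℝ) → ℂ} (hu : ContDiff ℝ ∞ u) (j : Fin n →₀ ℕ) :
    ContDiff ℝ ∞ (multiDeriv j u) := contDiff_foldr_partialDeriv hu j _

theorem tsupport_iterate_partialDeriv (u : (Fin n → ℝ) → ℂ) (i : Fin n) (k : ℕ) :
    tsupport ((partialDeriv i)^[k] u) ⊆ tsupport u := by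
  induction k with
  | zero => simp
  | succ k ih =>
    rw [Function.iterate_succ_apply']
    exact (tsupport_fderiv_apply_subset ℝ _).trans ih

theorem tsupport_multiDeriv (u : (Fin n → ℝ) → ℂ) (j : Fin n →₀ ℕ) :
    tsupport (multiDeriv j u) ⊆ tsupport u := by
  unfold multiDeriv
  induction List.finRange n with
  | nil => simp
  | cons k l ih => exact (tsupport_iterate_partialDeriv _ _ _).trans ih

theorem partialDeriv_comm {u : (Fin n → ℝ) → ℂ} (hu : ContDiff ℝ ∞ u) (i k : Fin n) :
    partialDeriv i (partialDeriv k u) = partialDeriv k (partialDeriv i u) :=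
  funext fun x => fderiv_fderiv_apply_comm hu _ _ x

theorem iterate_partialDeriv_comm {u : (Fin n → ℝ) → ℂ} (hu : ContDiff ℝ ∞ u) (i k : Fin n)
    (m : ℕ) : (partialDeriv k)^[m] (partialDeriv i u) = partialDeriv i ((partialDeriv k)^[m] u) := by
  induction m with
  | zero => rfl
  | succ m ih =>
    rw [Function.iterate_succ_apply', ih, Function.iterate_succ_apply',
      partialDeriv_comm (contDiff_iterate_partialDeriv hu k m)]

/-- `multiDeriv` applies the partial derivatives in a fixed order, so the additional `∂ᵢ` has to be
commuted past the outer ones; smoothness allows this. -/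
theorem multiDeriv_add_single {u : (Fin n → ℝ) → ℂ} (hu : ContDiff ℝ ∞ u) (j : Fin n →₀ ℕ)
    (i : Fin n) :
    multiDeriv (j + Finsupp.single i 1) u = partialDeriv i (multiDeriv j u) := by
  have key : ∀ l : List (Fin n), l.Nodup →
      (i ∉ l → l.foldr (fun k v => (partialDeriv k)^[(j + Finsupp.single i 1 : Fin n →₀ ℕ) k] v) u =
        l.foldr (fun k v => (partialDeriv k)^[j k] v) u) ∧
      (i ∈ l → l.foldr (fun k v => (partialDeriv k)^[(j + Finsupp.single i 1 : Fin n →₀ ℕ) k] v) u =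
        partialDeriv i (l.foldr (fun k v => (partialDeriv k)^[j k] v) u)) := by
    intro l hl
    induction l with
    | nil => simp
    | cons k l ih =>
      rw [List.nodup_cons] at hl
      obtain ⟨ih₁, ih₂⟩ := ih hl.2
      constructor
      · intro hi
        rw [List.mem_cons, not_or] at hi
        simp only [List.foldr_cons]
        rw [ih₁ hi.2]
        simp [hi.1]
      · intro hi
        simp only [List.foldr_cons]
        by_cases hik : i = k
        · subst hik
          rw [ih₁ hl.1]
          simp only [Finsupp.add_apply, Finsupp.single_eq_same]
          rw [Function.iterate_succ_apply']
        · rw [ih₂ ((List.mem_cons.1 hi).resolve_left hik)]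
          simp only [Finsupp.add_apply, Finsupp.single_apply, hik, if_false, add_zero]
          exact iterate_partialDeriv_comm (contDiff_foldr_partialDeriv hu j l) i k _
  exact (key _ (List.nodup_finRange n)).2 (List.mem_finRange i)

theorem transposeOp_eq_sum_of_subset (P : MvPolynomial (Fin n) ℂ) (φ : (Fin n → ℝ) → ℂ)
    {s : Finset (Fin n →₀ ℕ)} (hs : P.support ⊆ s) (x : Fin n → ℝ) :
    transposeOp P φ x = ∑ j ∈ s, (-1) ^ (∑ i, j i) * P.coeff j * multiDeriv j φ x :=
  Finset.sum_subset hs fun j _ hj => by simp [MvPolynomial.notMem_support_iff.1 hj]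

theorem transposeOp_add (P Q : MvPolynomial (Fin n) ℂ) (φ : (Fin n → ℝ) → ℂ) :
    transposeOp (P + Q) φ = transposeOp P φ + transposeOp Q φ := by
  classical
  funext x
  rw [Pi.add_apply, transposeOp_eq_sum_of_subset _ _ MvPolynomial.support_add,
    transposeOp_eq_sum_of_subset P _ Finset.subset_union_left,
    transposeOp_eq_sum_of_subset Q _ Finset.subset_union_right, ← Finset.sum_add_distrib]
  exact Finset.sum_congr rfl fun j _ => by rw [MvPolynomial.coeff_add]; ring

theorem transposeOp_monomial (j : Fin n →₀ ℕ) (a : ℂ) (φ : (Fin n → ℝ) → ℂ) (x : Fin n → ℝ) :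
    transposeOp (MvPolynomial.monomial j a) φ x = (-1) ^ (∑ i, j i) * a * multiDeriv j φ x := by
  classical
  rw [transposeOp_eq_sum_of_subset _ _ MvPolynomial.support_monomial_subset]
  simp

theorem multiDeriv_zero (φ : (Fin n → ℝ) → ℂ) : multiDeriv 0 φ = φ := by
  simp [multiDeriv]

theorem transposeOp_C (a : ℂ) (φ : (Fin n → ℝ) → ℂ) :
    transposeOp (MvPolynomial.C a) φ = a • φ := by
  funext x
  rw [MvPolynomial.C_apply, transposeOp_monomial, multiDeriv_zero]
  simp

theorem contDiff_transposeOp (P : MvPolynomial (Fin n) ℂ) {φ : (Fin n → ℝ) → ℂ}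
    (hφ : ContDiff ℝ ∞ φ) : ContDiff ℝ ∞ (transposeOp P φ) :=
  ContDiff.sum fun j _ => contDiff_const.mul (contDiff_multiDeriv hφ j)

theorem tsupport_transposeOp (P : MvPolynomial (Fin n) ℂ) (φ : (Fin n → ℝ) → ℂ) :
    tsupport (transposeOp P φ) ⊆ tsupport φ := by
  refine closure_minimal (fun x hx => ?_) (isClosed_tsupport _)
  by_contra h
  refine hx (Finset.sum_eq_zero fun j _ => ?_)
  rw [image_eq_zero_of_notMem_tsupport fun h' => h (tsupport_multiDeriv φ j h'), mul_zero]

theorem transposeOp_mul_X (P : MvPolynomial (Fin n) ℂ) (i : Fin n) {φ : (Fin n → ℝ) → ℂ}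
    (hφ : ContDiff ℝ ∞ φ) :
    transposeOp (P * MvPolynomial.X i) φ = -partialDeriv i (transposeOp P φ) := by
  induction P using MvPolynomial.induction_on' with
  | monomial j a =>
    funext x
    have h1 : transposeOp (MvPolynomial.monomial j a) φ =
        fun y => ((-1) ^ (∑ i, j i) * a) * multiDeriv j φ y :=
      funext fun y => transposeOp_monomial j a φ y
    have hd : DifferentiableAt ℝ (multiDeriv j φ) x :=
      ((contDiff_multiDeriv hφ j).differentiable (by simp)).differentiableAt
    have h2 : ∑ k, (j + Finsupp.single i 1 : Fin n →₀ ℕ) k = ∑ k, j k + 1 := by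
      simp [Finset.sum_add_distrib, Finsupp.single_apply]
    rw [MvPolynomial.X, MvPolynomial.monomial_mul, mul_one, transposeOp_monomial,
      multiDeriv_add_single hφ, h1, h2, Pi.neg_apply]
    simp only [partialDeriv]
    rw [fderiv_const_mul hd]
    simp
    ring
  | add P Q hP hQ =>
    have hd : ∀ R : MvPolynomial (Fin n) ℂ, Differentiable ℝ (transposeOp R φ) := fun R =>
      (contDiff_transposeOp R hφ).differentiable (by simp)
    rw [add_mul, transposeOp_add, hP, hQ, transposeOp_add]
    funext x
    simp only [partialDeriv, Pi.add_apply, Pi.neg_apply]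
    rw [fderiv_add (hd P x) (hd Q x), add_apply]
    ring

theorem transposeOp_X (i : Fin n) {φ : (Fin n → ℝ) → ℂ} (hφ : ContDiff ℝ ∞ φ) :
    transposeOp (MvPolynomial.X i) φ = -partialDeriv i φ := by
  have h := transposeOp_mul_X 1 i hφ
  rwa [one_mul, ← MvPolynomial.C_1, transposeOp_C, one_smul] at h

theorem transposeOp_C_mul (a : ℂ) (P : MvPolynomial (Fin n) ℂ) (φ : (Fin n → ℝ) → ℂ) :
    transposeOp (MvPolynomial.C a * P) φ = a • transposeOp P φ := by
  funext x
  have hs : (MvPolynomial.C a * P).support ⊆ P.support := by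
    intro j hj
    rw [MvPolynomial.mem_support_iff, MvPolynomial.coeff_C_mul] at hj
    exact MvPolynomial.mem_support_iff.2 (right_ne_zero_of_mul hj)
  rw [transposeOp_eq_sum_of_subset _ _ hs, Pi.smul_apply, transposeOp, smul_eq_mul, Finset.mul_sum]
  exact Finset.sum_congr rfl fun j _ => by rw [MvPolynomial.coeff_C_mul]; ring

theorem transposeOp_mul (P Q : MvPolynomial (Fin n) ℂ) {φ : (Fin n → ℝ) → ℂ}
    (hφ : ContDiff ℝ ∞ φ) : transposeOp (P * Q) φ = transposeOp P (transposeOp Q φ) := by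
  induction P using MvPolynomial.induction_on generalizing Q φ with
  | C a => rw [transposeOp_C_mul, transposeOp_C]
  | add P R hP hR => rw [add_mul, transposeOp_add, hP Q hφ, hR Q hφ, transposeOp_add]
  | mul_X P i hP =>
    have hψ := contDiff_transposeOp Q hφ
    rw [hP _ hψ, transposeOp_X i hψ, ← transposeOp_mul_X Q i hφ, mul_assoc, hP _ hφ, mul_comm Q]

/-- If `R = P Q`, then `Rᵗ φ = Pᵗ (Qᵗ φ)`, and `Qᵗ φ` is again a test function in `D`. -/
theorem nullSpace_subset_of_dvd {D : Set (Fin n → ℝ)} {P R : MvPolynomial (Fin n) ℂ} (h : P ∣ R) :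
    nullSpace D P ⊆ nullSpace D R := by
  rintro w ⟨hw, hw'⟩
  refine ⟨hw, fun φ hφ hc hs => ?_⟩
  obtain ⟨Q, rfl⟩ := h
  rw [transposeOp_mul P Q hφ]
  exact hw' _ (contDiff_transposeOp Q hφ)
    (hc.of_isClosed_subset (isClosed_tsupport _) (tsupport_transposeOp Q φ))
    ((tsupport_transposeOp Q φ).trans hs)

/-- The exponential `x ↦ exp (z · x)`. -/
noncomputable def expFun (z : Fin n → ℂ) (x : Fin n → ℝ) : ℂ := Complex.exp (∑ i, z i * x i)

theorem hasFDerivAt_expFun (z : Fin n → ℂ) (x : Fin n → ℝ) :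
    HasFDerivAt (expFun z)
      (expFun z x • ∑ i, z i • Complex.ofRealCLM.comp (ContinuousLinearMap.proj (R := ℝ) i)) x := by
  refine HasFDerivAt.cexp ?_
  refine HasFDerivAt.fun_sum fun i _ => ?_
  exact ((Complex.ofRealCLM.comp
    (ContinuousLinearMap.proj (R := ℝ) (φ := fun _ : Fin n => ℝ) i)).hasFDerivAt).const_mul (z i)

theorem contDiff_expFun (z : Fin n → ℂ) : ContDiff ℝ ∞ (expFun z) := by
  unfold expFun
  refine ContDiff.cexp (ContDiff.sum fun i _ => contDiff_const.mul ?_)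
  exact Complex.ofRealCLM.contDiff.comp (contDiff_apply ℝ ℝ i)

theorem integral_expFun_mul_partialDeriv (z : Fin n → ℂ) (i : Fin n) {φ : (Fin n → ℝ) → ℂ}
    (hφ : ContDiff ℝ ∞ φ) (hc : HasCompactSupport φ) :
    ∫ x, expFun z x * partialDeriv i φ x = -(z i * ∫ x, expFun z x * φ x) := by
  have hcE := (contDiff_expFun z).continuous
  have hfd : ∀ x, fderiv ℝ (expFun z) x (Pi.single i 1) = z i * expFun z x := fun x => by
    rw [(hasFDerivAt_expFun z x).fderiv]
    simp [Pi.single_apply, apply_ite, mul_comm]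
  have hcp : HasCompactSupport (partialDeriv i φ) :=
    hc.of_isClosed_subset (isClosed_tsupport _) (tsupport_fderiv_apply_subset ℝ _)
  have h := integral_mul_fderiv_eq_neg_fderiv_mul_of_integrable (μ := volume)
    (f := expFun z) (g := φ) (v := Pi.single i 1)
    (by
      simp only [hfd]
      exact ((continuous_const.mul hcE).mul hφ.continuous).integrable_of_hasCompactSupport
        hc.mul_left)
    ((hcE.mul (contDiff_partialDeriv hφ i).continuous).integrable_of_hasCompactSupport
      hcp.mul_left)
    ((hcE.mul hφ.continuous).integrable_of_hasCompactSupport hc.mul_left)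
    (fun x _ => (hasFDerivAt_expFun z x).differentiableAt)
    (fun x _ => (hφ.differentiable (by simp)) x)
  simp only [hfd, mul_assoc, integral_const_mul] at h
  exact h

/-- The exponential is an eigenfunction of every `∂ᵢ`. The signs from integrating by parts cancel
those of the transpose, leaving the eigenvalue `P(z)`. -/
theorem integral_expFun_mul_transposeOp (z : Fin n → ℂ) (P : MvPolynomial (Fin n) ℂ)
    {φ : (Fin n → ℝ) → ℂ} (hφ : ContDiff ℝ ∞ φ) (hc : HasCompactSupport φ) :
    ∫ x, expFun z x * transposeOp P φ x = MvPolynomial.eval z P * ∫ x, expFun z x * φ x := by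
  have hcT : ∀ R : MvPolynomial (Fin n) ℂ, HasCompactSupport (transposeOp R φ) := fun R =>
    hc.of_isClosed_subset (isClosed_tsupport _) (tsupport_transposeOp R φ)
  induction P using MvPolynomial.induction_on with
  | C a =>
    simp only [transposeOp_C, Pi.smul_apply, smul_eq_mul, MvPolynomial.eval_C, mul_left_comm _ a,
      integral_const_mul]
  | add P Q hP hQ =>
    have hi : ∀ R : MvPolynomial (Fin n) ℂ, Integrable fun x => expFun z x * transposeOp R φ x :=
      fun R => ((contDiff_expFun z).continuous.mul
        (contDiff_transposeOp R hφ).continuous).integrable_of_hasCompactSupport (hcT R).mul_left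
    simp only [transposeOp_add, Pi.add_apply, mul_add, map_add, add_mul]
    rw [integral_add (hi P) (hi Q), hP, hQ]
  | mul_X P i hP =>
    simp only [transposeOp_mul_X P i hφ, Pi.neg_apply, mul_neg, integral_neg]
    rw [integral_expFun_mul_partialDeriv z i (contDiff_transposeOp P hφ) (hcT P), hP, neg_neg,
      map_mul, MvPolynomial.eval_X]
    ring

theorem expFun_mem_nullSpace (D : Set (Fin n → ℝ)) {P : MvPolynomial (Fin n) ℂ} {z : Fin n → ℂ}
    (hz : z ∈ charVariety P) : expFun z ∈ nullSpace D P := by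
  refine ⟨(contDiff_expFun z).continuous.locallyIntegrable.locallyIntegrableOn D,
    fun φ hφ hc hs => ?_⟩
  rw [setIntegral_eq_integral_of_forall_compl_eq_zero, integral_expFun_mul_transposeOp z P hφ hc,
    show MvPolynomial.eval z P = 0 from hz, zero_mul]
  intro x hx
  rw [image_eq_zero_of_notMem_tsupport fun h => hx (hs (tsupport_transposeOp P φ h)), mul_zero]

theorem expFun_mul (z w : Fin n → ℂ) (x : Fin n → ℝ) :
    expFun z x * expFun w x = expFun (z + w) x := by
  rw [expFun, expFun, expFun, ← Complex.exp_add, ← Finset.sum_add_distrib]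
  simp [add_mul]

end TransposeOp

/-! ### Transversality implies totality -/

section Sufficiency

open BoundedContinuousFunction

variable {n : ℕ}

/-- The `i`-th coordinate truncated to `[-R, R]`, as a bounded continuous function. -/
noncomputable def clampCoord (R : ℝ) (i : Fin n) : BoundedContinuousFunction (Fin n → ℝ) ℂ :=
  BoundedContinuousFunction.ofNormedAddCommGroup
    (fun x => ((max (-R) (min R (x i)) : ℝ) : ℂ)) (by fun_prop) |R| (fun x => by
      rw [Complex.norm_real, Real.norm_eq_abs, abs_le]
      constructor
      · exact (neg_le_neg (le_abs_self R)).trans (le_max_left _ _)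
      · exact max_le (neg_le_abs R) ((min_le_left _ _).trans (le_abs_self R)))

theorem clampCoord_apply {R : ℝ} {x : Fin n → ℝ} {i : Fin n} (hx : |x i| ≤ R) :
    clampCoord R i x = x i := by
  rw [abs_le] at hx
  show ((max (-R) (min R (x i)) : ℝ) : ℂ) = x i
  rw [min_eq_right hx.2, max_eq_right hx.1]

/-- A bounded continuous function that agrees with `x ↦ exp (z · x)` on the cube `[-R, R]ⁿ`. -/
noncomputable def clampExp (R : ℝ) (z : Fin n → ℂ) : BoundedContinuousFunction (Fin n → ℝ) ℂ :=
  NormedSpace.exp (∑ i, z i • clampCoord R i)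

theorem clampExp_apply (R : ℝ) (z : Fin n → ℂ) (x : Fin n → ℝ) :
    clampExp R z x = Complex.exp (∑ i, z i * clampCoord R i x) := by
  let ev : BoundedContinuousFunction (Fin n → ℝ) ℂ →+* ℂ :=
    { toFun := fun f => f x
      map_one' := rfl
      map_mul' := fun _ _ => rfl
      map_zero' := rfl
      map_add' := fun _ _ => rfl }
  have hev : Continuous ev := (BoundedContinuousFunction.evalCLM ℂ x).continuous
  have h := NormedSpace.map_exp ev hev (∑ i, z i • clampCoord R i)
  rw [← Complex.exp_eq_exp_ℂ] at h
  refine h.trans ?_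
  congr 1
  rw [map_sum]
  rfl

theorem clampExp_eq_expFun {R : ℝ} (z : Fin n → ℂ) {x : Fin n → ℝ} (hx : ∀ i, |x i| ≤ R) :
    clampExp R z x = expFun z x := by
  rw [clampExp_apply, expFun]
  congr 1
  exact Finset.sum_congr rfl fun i _ => by rw [clampCoord_apply (hx i)]

/-- Truncating the coordinates places the exponentials in a Banach algebra, where this family is the
algebra exponential of a continuous linear map of `z`. -/
theorem analyticAt_clampExp (R : ℝ) (z : Fin n → ℂ) :
    AnalyticAt ℂ (clampExp R : (Fin n → ℂ) → BoundedContinuousFunction (Fin n → ℝ) ℂ) z := by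
  let L : (Fin n → ℂ) →L[ℂ] BoundedContinuousFunction (Fin n → ℝ) ℂ :=
    ∑ i, (ContinuousLinearMap.proj (R := ℂ) (φ := fun _ : Fin n => ℂ) i).smulRight (clampCoord R i)
  have hL : (clampExp R : (Fin n → ℂ) → BoundedContinuousFunction (Fin n → ℝ) ℂ) =
      fun z => NormedSpace.exp (L z) := by
    funext z
    simp [clampExp, L]
  rw [hL]
  exact (NormedSpace.exp_analytic (𝕂 := ℂ) (L z)).comp (L.analyticAt z)

theorem clampExp_mul (R : ℝ) (z w : Fin n → ℂ) :
    clampExp R z * clampExp R w = clampExp R (z + w) := by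
  ext x
  rw [BoundedContinuousFunction.mul_apply, clampExp_apply, clampExp_apply, clampExp_apply,
    ← Complex.exp_add, ← Finset.sum_add_distrib]
  simp [add_mul]

/-- The restrictions to the cube of the combinations of exponentials form a star subalgebra. -/
noncomputable def expStarSubalgebra (R : ℝ) :
    StarSubalgebra ℂ C({x : Fin n → ℝ | ∀ i, |x i| ≤ R}, ℂ) where
  carrier := {g | ∃ h ∈ Submodule.span ℂ (Set.range (clampExp (n := n) R)), ∀ x, g x = h x}
  mul_mem' := by
    rintro a b ⟨f, hf, hfa⟩ ⟨g, hg, hgb⟩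
    refine ⟨f * g, ?_, fun x => by simp [hfa, hgb]⟩
    induction hf, hg using Submodule.span_induction₂ generalizing a b with
    | mem_mem x y hx hy =>
      obtain ⟨z, rfl⟩ := hx
      obtain ⟨w, rfl⟩ := hy
      rw [clampExp_mul]
      exact Submodule.subset_span ⟨_, rfl⟩
    | zero_left y _ => simp
    | zero_right x _ => simp
    | add_left x y z _ _ _ h1 h2 =>
      rw [add_mul]
      exact Submodule.add_mem _
        (h1 (a := ⟨fun u => x u, by fun_prop⟩) (b := ⟨fun u => z u, by fun_prop⟩)
          (fun _ => rfl) (fun _ => rfl))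
        (h2 (a := ⟨fun u => y u, by fun_prop⟩) (b := ⟨fun u => z u, by fun_prop⟩)
          (fun _ => rfl) (fun _ => rfl))
    | add_right x y z _ _ _ h1 h2 =>
      rw [mul_add]
      exact Submodule.add_mem _
        (h1 (a := ⟨fun u => x u, by fun_prop⟩) (b := ⟨fun u => y u, by fun_prop⟩)
          (fun _ => rfl) (fun _ => rfl))
        (h2 (a := ⟨fun u => x u, by fun_prop⟩) (b := ⟨fun u => z u, by fun_prop⟩)
          (fun _ => rfl) (fun _ => rfl))
    | smul_left r x y _ _ h =>
      rw [smul_mul_assoc]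
      exact Submodule.smul_mem _ _
        (h (a := ⟨fun u => x u, by fun_prop⟩) (b := ⟨fun u => y u, by fun_prop⟩)
          (fun _ => rfl) (fun _ => rfl))
    | smul_right r x y _ _ h =>
      rw [mul_smul_comm]
      exact Submodule.smul_mem _ _
        (h (a := ⟨fun u => x u, by fun_prop⟩) (b := ⟨fun u => y u, by fun_prop⟩)
          (fun _ => rfl) (fun _ => rfl))
  add_mem' := by
    rintro a b ⟨f, hf, hfa⟩ ⟨g, hg, hgb⟩
    exact ⟨f + g, Submodule.add_mem _ hf hg, fun x => by simp [hfa, hgb]⟩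
  algebraMap_mem' r := by
    refine ⟨r • clampExp R 0, Submodule.smul_mem _ _ (Submodule.subset_span ⟨_, rfl⟩), fun x => ?_⟩
    simp [clampExp_apply]
  star_mem' := by
    rintro a ⟨f, hf, hfa⟩
    have key : ∃ g ∈ Submodule.span ℂ (Set.range (clampExp (n := n) R)),
        ∀ x, g x = (starRingEnd ℂ) (f x) := by
      clear hfa
      induction hf using Submodule.span_induction with
      | mem x hx =>
        obtain ⟨z, rfl⟩ := hx
        refine ⟨clampExp R (star z), Submodule.subset_span ⟨_, rfl⟩, fun x => ?_⟩
        rw [clampExp_apply, clampExp_apply, ← Complex.exp_conj, map_sum]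
        simp [clampCoord]
      | zero => exact ⟨0, Submodule.zero_mem _, fun x => by simp⟩
      | add x y _ _ hx hy =>
        obtain ⟨gx, hgx, hx⟩ := hx
        obtain ⟨gy, hgy, hy⟩ := hy
        exact ⟨gx + gy, Submodule.add_mem _ hgx hgy, fun u => by simp [hx, hy]⟩
      | smul r x _ hx =>
        obtain ⟨gx, hgx, hx⟩ := hx
        exact ⟨(starRingEnd ℂ) r • gx, Submodule.smul_mem _ _ hgx, fun u => by simp [hx]⟩
    obtain ⟨g, hg, hgf⟩ := key
    exact ⟨g, hg, fun x => by simp [hgf, hfa]⟩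

theorem expStarSubalgebra_separatesPoints (R : ℝ) :
    (expStarSubalgebra (n := n) R).SeparatesPoints := by
  intro x y hxy
  obtain ⟨i, hi⟩ : ∃ i, x.1 i ≠ y.1 i := by
    by_contra! hc
    exact hxy (Subtype.ext (funext hc))
  refine ⟨_, ⟨⟨fun u => clampExp R (Pi.single i 1) u, by fun_prop⟩,
    ⟨_, Submodule.subset_span ⟨Pi.single i 1, rfl⟩, fun _ => rfl⟩, rfl⟩, ?_⟩
  have h : ∀ u : {x : Fin n → ℝ | ∀ i, |x i| ≤ R},
      clampExp R (Pi.single i 1) u = (Real.exp (u.1 i) : ℂ) := fun u => by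
    rw [clampExp_eq_expFun _ u.2, expFun, Finset.sum_eq_single i] <;> simp +contextual
  show clampExp R (Pi.single i 1) x ≠ clampExp R (Pi.single i 1) y
  rw [h, h]
  exact fun h' => hi (Real.exp_injective (Complex.ofReal_injective h'))

/-- Stone–Weierstrass on the cube. The span is closed under conjugation because `x` is real, so that
conjugating `exp (z · x)` conjugates only `z`. -/
theorem exists_span_clampExp_near {R : ℝ} (f : BoundedContinuousFunction (Fin n → ℝ) ℂ) {ε : ℝ}
    (hε : 0 < ε) : ∃ h ∈ Submodule.span ℂ (Set.range (clampExp (n := n) R)),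
      ∀ x : Fin n → ℝ, (∀ i, |x i| ≤ R) → ‖h x - f x‖ ≤ ε := by
  have hK : IsCompact {x : Fin n → ℝ | ∀ i, |x i| ≤ R} := by
    have : {x : Fin n → ℝ | ∀ i, |x i| ≤ R} = Set.pi Set.univ fun _ => Set.Icc (-R) R := by
      ext x
      simp [abs_le, Pi.le_def, forall_and]
    rw [this]
    exact isCompact_univ_pi fun _ => isCompact_Icc
  have : CompactSpace {x : Fin n → ℝ | ∀ i, |x i| ≤ R} := isCompact_iff_compactSpace.1 hK
  have hd := ContinuousMap.starSubalgebra_topologicalClosure_eq_top_of_separatesPoints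
    (expStarSubalgebra (n := n) R) (expStarSubalgebra_separatesPoints R)
  let f' : C({x : Fin n → ℝ | ∀ i, |x i| ≤ R}, ℂ) := ⟨fun u => f u, by fun_prop⟩
  have hf' : f' ∈ (expStarSubalgebra (n := n) R).topologicalClosure := by
    rw [hd]
    trivial
  have hf'' : f' ∈ closure ((expStarSubalgebra (n := n) R : Set _)) := hf'
  obtain ⟨g, ⟨h, hh, hgh⟩, hg⟩ := Metric.mem_closure_iff.1 hf'' ε hε
  refine ⟨h, hh, fun x hx => ?_⟩
  rw [← dist_eq_norm, dist_comm]
  have := ContinuousMap.dist_apply_le_dist (f := f') (g := g) ⟨x, hx⟩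
  rw [hgh] at this
  exact this.trans hg.le

theorem productsTotal_of_transversal {D : Set (Fin n → ℝ)} (hD : IsOpen D)
    (hDb : Bornology.IsBounded D) {p : ℝ≥0∞} [Fact (1 ≤ p)] (hp : p ≠ ⊤)
    (P₁ P₂ : MvPolynomial (Fin n) ℂ) (hP₁ : 1 ≤ P₁.totalDegree) (hP₂ : 1 ≤ P₂.totalDegree)
    (hT : VarietiesTransversal (charVariety P₁) (charVariety P₂)) : ProductsTotal D p P₁ P₂ := by
  obtain ⟨z₀, hz₀⟩ := eventually_mem_add_of_transversal P₁ P₂ hP₁ hP₂ hT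
  obtain ⟨R, hR⟩ := hDb.subset_closedBall 0
  have hDR : ∀ x ∈ D, ∀ i, |x i| ≤ R := fun x hx i => by
    have h1 := hR hx
    rw [mem_closedBall_zero_iff] at h1
    exact (norm_le_pi_norm x i).trans h1
  have : IsFiniteMeasure (volume.restrict D) := ⟨by
    rw [Measure.restrict_apply_univ]
    exact hDb.measure_lt_top⟩
  set T : BoundedContinuousFunction (Fin n → ℝ) ℂ →L[ℂ] Lp ℂ p (volume.restrict D) :=
    BoundedContinuousFunction.toLp p (volume.restrict D) ℂ with hTdef
  set M := (Submodule.span ℂ (nullProducts D p P₁ P₂)).topologicalClosure with hM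
  have hMc : IsClosed (M : Set (Lp ℂ p (volume.restrict D))) :=
    Submodule.isClosed_topologicalClosure _
  -- Analytic continuation in the quotient by the closed span `M`: the class of the exponential
  -- vanishes for `z` near `z₀`, where `z = z₁ + z₂`, hence for every `z`.
  have hexp : ∀ z, T (clampExp R z) ∈ M := by
    have hana : AnalyticOnNhd ℂ (fun z => M.mkQL (T (clampExp R z))) Set.univ := fun z _ =>
      ((M.mkQL.comp T).analyticAt _).comp (analyticAt_clampExp R z)
    have hev : (fun z => M.mkQL (T (clampExp R z))) =ᶠ[nhds z₀] 0 := by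
      filter_upwards [hz₀] with z ⟨z₁, hz₁, z₂, hz₂, hz⟩
      rw [Pi.zero_apply, Submodule.mkQL_apply, Submodule.mkQ_apply, Submodule.Quotient.mk_eq_zero]
      refine Submodule.le_topologicalClosure _ (Submodule.subset_span ?_)
      refine ⟨expFun z₁, expFun_mem_nullSpace D hz₁, expFun z₂, expFun_mem_nullSpace D hz₂, ?_⟩
      refine (BoundedContinuousFunction.coeFn_toLp p _ ℂ _).trans ?_
      filter_upwards [ae_restrict_mem hD.measurableSet] with x hx
      rw [clampExp_eq_expFun _ (hDR x hx), expFun_mul, hz]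
    intro z
    have : M.mkQL (T (clampExp R z)) = 0 := hana.eqOn_zero_of_preconnected_of_eventuallyEq_zero isPreconnected_univ
      (Set.mem_univ z₀) hev (Set.mem_univ z)
    rwa [Submodule.mkQL_apply, Submodule.mkQ_apply,
      Submodule.Quotient.mk_eq_zero] at this
  have hspan : ∀ h ∈ Submodule.span ℂ (Set.range (clampExp (n := n) R)), T h ∈ M := by
    intro h hh
    have : Submodule.span ℂ (Set.range (clampExp (n := n) R)) ≤ M.comap (T : _ →ₗ[ℂ] _) :=
      Submodule.span_le.2 (by
        rintro _ ⟨z, rfl⟩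
        exact hexp z)
    exact this hh
  have hall : ∀ f, T f ∈ M := by
    intro f
    refine hMc.closure_subset (Metric.mem_closure_iff.2 fun ε hε => ?_)
    -- `κ` is the factor by which a uniform bound on `D` controls the `L^p` norm. The `+ 1` in the
    -- tolerance below avoids division by zero.
    set κ : ℝ := measureUnivNNReal (volume.restrict D) ^ p.toReal⁻¹ with hκ
    have hκ0 : 0 ≤ κ := by positivity
    obtain ⟨h, hh, hhf⟩ := exists_span_clampExp_near (R := R) f
      (ε := ε / (2 * (κ + 1))) (by positivity)
    refine ⟨T h, hspan h hh, ?_⟩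
    rw [dist_comm, dist_eq_norm, ← map_sub]
    have hb := Lp.norm_le_of_ae_bound (f := T (h - f)) (C := ε / (2 * (κ + 1))) (by positivity) (by
      filter_upwards [BoundedContinuousFunction.coeFn_toLp p (volume.restrict D) ℂ (h - f),
        ae_restrict_mem hD.measurableSet] with x hx hxD
      rw [hTdef, hx]
      exact hhf x (hDR x hxD))
    refine hb.trans_lt ?_
    have : κ * (ε / (2 * (κ + 1))) = ε * (κ / (2 * (κ + 1))) := by ring
    change κ * _ < ε
    rw [this]
    have h1 : κ / (2 * (κ + 1)) < 1 := by
      rw [div_lt_one (by positivity)]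
      linarith
    nlinarith
  have hdr := BoundedContinuousFunction.toLp_denseRange ℂ (volume.restrict D) ℂ (p := p) hp
  have htop : (M : Set (Lp ℂ p (volume.restrict D))) = Set.univ := by
    rw [← hMc.closure_eq]
    refine (hdr.mono ?_).closure_eq
    rintro _ ⟨f, rfl⟩
    exact hall f
  rw [ProductsTotal, dense_iff_closure_eq, ← htop]
  rfl

end Sufficiency

/-! ### Complex vector fields and their parametrices -/

section ComplexVectorField

variable {E : Type*} [NormedAddCommGroup E] [NormedSpace ℝ E]

/-- The derivative of `f` along the constant complex vector field `a + i b`. -/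
noncomputable def cDeriv (a b : E) (f : E → ℂ) : E → ℂ :=
  fun x => fderiv ℝ f x a + Complex.I * fderiv ℝ f x b

variable {a b : E} {f g : E → ℂ}

theorem contDiff_cDeriv (hf : ContDiff ℝ ∞ f) : ContDiff ℝ ∞ (cDeriv a b f) :=
  (contDiff_fderiv_apply_const hf a).add
    (contDiff_const.mul (contDiff_fderiv_apply_const hf b))

theorem tsupport_cDeriv : tsupport (cDeriv a b f) ⊆ tsupport f := by
  refine closure_minimal (fun x hx => ?_) (isClosed_tsupport _)
  by_contra h
  refine hx ?_
  have hz : fderiv ℝ f x = 0 := image_eq_zero_of_notMem_tsupport fun h' =>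
    h (tsupport_fderiv_subset ℝ h')
  simp [cDeriv, hz]

theorem cDeriv_mul {x : E} (hf : DifferentiableAt ℝ f x) (hg : DifferentiableAt ℝ g x) :
    cDeriv a b (fun y => f y * g y) x = cDeriv a b f x * g x + f x * cDeriv a b g x := by
  simp only [cDeriv]
  rw [fderiv_fun_mul hf hg]
  simp
  ring

theorem cDeriv_add {x : E} (hf : DifferentiableAt ℝ f x) (hg : DifferentiableAt ℝ g x) :
    cDeriv a b (fun y => f y + g y) x = cDeriv a b f x + cDeriv a b g x := by
  simp only [cDeriv]
  rw [fderiv_fun_add hf hg]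
  simp
  ring

theorem cDeriv_const_mul {x : E} (c : ℂ) (hf : DifferentiableAt ℝ f x) :
    cDeriv a b (fun y => c * f y) x = c * cDeriv a b f x := by
  simp only [cDeriv]
  rw [fderiv_const_mul hf]
  simp
  ring

theorem cDeriv_congr {x : E} (h : f =ᶠ[nhds x] g) : cDeriv a b f x = cDeriv a b g x := by
  simp only [cDeriv, h.fderiv_eq]

theorem cDeriv_exp (l : E →L[ℝ] ℂ) (hl : l a + Complex.I * l b = 1) (s : ℂ) (x : E) :
    cDeriv a b (fun y => Complex.exp (s * l y)) x = s * Complex.exp (s * l x) := by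
  have h : HasFDerivAt (fun y => Complex.exp (s * l y)) (Complex.exp (s * l x) • (s • l)) x :=
    (l.hasFDerivAt.const_mul s).cexp
  simp only [cDeriv, h.fderiv, smul_apply, smul_eq_mul]
  linear_combination (Complex.exp (s * l x) * s) * hl

theorem contDiff_exp_mul_clm (l : E →L[ℝ] ℂ) (s : ℂ) :
    ContDiff ℝ ∞ fun y => Complex.exp (s * l y) :=
  (contDiff_const.mul l.contDiff).cexp

/-- The vector field `a + i b` has a locally integrable fundamental solution, smooth away from the
origin. -/
def HasFundamentalSolution [MeasurableSpace E] (μ : Measure E) (a b : E) : Prop :=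
  ∃ e : E → ℂ, LocallyIntegrable e μ ∧ ContDiffOn ℝ ∞ e {0}ᶜ ∧
    ∀ g : E → ℂ, ContDiff ℝ ∞ g → HasCompactSupport g → ∫ y, e y * cDeriv a b g y ∂μ = -g 0

/-- A parametrix: the value at the origin is recovered, up to a smoothing term, from
`-(∂ f + s f)` near the origin. -/
theorem HasFundamentalSolution.exists_parametrix [FiniteDimensional ℝ E] [MeasurableSpace E]
    [BorelSpace E] {μ : Measure E} (h : HasFundamentalSolution μ a b) (l : E →L[ℝ] ℂ)
    (hl : l a + Complex.I * l b = 1) (s : ℂ) {ε : ℝ} (hε : 0 < ε) :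
    ∃ G ρ : E → ℂ, Integrable G μ ∧ (∀ y, ε ≤ ‖y‖ → G y = 0) ∧ ContDiff ℝ ∞ ρ ∧
      (∀ y, ε ≤ ‖y‖ → ρ y = 0) ∧ ∀ f : E → ℂ, ContDiff ℝ ∞ f →
        f 0 = ∫ y, ρ y * f y ∂μ + ∫ y, G y * (-cDeriv a b f y - s * f y) ∂μ := by
  obtain ⟨e, he, hes, hfs⟩ := h
  -- The outer radius `ε / 2` is smaller than `ε`, so `χ` vanishes in a neighbourhood of each point
  -- with `‖y‖ ≥ ε`, and so does its derivative.
  let χ' : ContDiffBump (0 : E) := ⟨ε / 4, ε / 2, by positivity, by linarith⟩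
  let χ : E → ℂ := fun y => (χ' y : ℂ)
  have hχ : ContDiff ℝ ∞ χ := Complex.ofRealCLM.contDiff.comp χ'.contDiff
  have hχs : ∀ y, ε / 2 ≤ ‖y‖ → χ y = 0 := fun y hy => by
    have : χ' y = 0 := χ'.zero_of_le_dist (by simpa using hy)
    simp [χ, this]
  have hχc : HasCompactSupport χ :=
    HasCompactSupport.of_support_subset_isCompact (isCompact_closedBall 0 (ε / 2)) (by
      intro y hy
      by_contra hy'
      rw [mem_closedBall_zero_iff, not_le] at hy'
      exact hy (hχs y hy'.le))
  have hdχ : ContDiff ℝ ∞ (cDeriv a b χ) := contDiff_cDeriv hχ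
  have hdχc : HasCompactSupport (cDeriv a b χ) :=
    hχc.of_isClosed_subset (isClosed_tsupport _) tsupport_cDeriv
  have hdχs : ∀ y, ε ≤ ‖y‖ → cDeriv a b χ y = 0 := by
    intro y hy
    have hev : χ =ᶠ[nhds y] fun _ => 0 := by
      have : ∀ᶠ z in nhds y, ε / 2 < ‖z‖ :=
        (continuous_norm.tendsto y).eventually (lt_mem_nhds (by linarith))
      filter_upwards [this] with z hz
      exact hχs z hz.le
    rw [cDeriv_congr hev]
    simp [cDeriv]
  have hdχ0 : cDeriv a b χ =ᶠ[nhds 0] fun _ => 0 := by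
    have h1 : χ =ᶠ[nhds 0] fun _ => 1 := by
      filter_upwards [χ'.eventuallyEq_one] with y hy
      simp [χ, hy]
    filter_upwards [h1.eventuallyEq_nhds] with y hy
    rw [cDeriv_congr hy]
    simp [cDeriv]
  have hint : ∀ u : E → ℂ, Continuous u → HasCompactSupport u →
      Integrable (fun y => e y * u y) μ := fun u hu huc =>
    he.integrable_smul_right_of_hasCompactSupport hu huc
  set w : E → ℂ := fun y => Complex.exp (s * l y) with hw
  have hws : ContDiff ℝ ∞ w := contDiff_exp_mul_clm l s
  -- Apply the fundamental solution to `χ w f` with `w = exp (s l)`, so that `∂ w = s w`. The terms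
  -- containing `∂ χ` form `ρ`, which is smooth because `∂ χ` vanishes near the singularity of `e`.
  refine ⟨fun y => e y * (χ y * w y), fun y => -(e y * cDeriv a b χ y) * w y,
    hint _ (hχ.mul hws).continuous hχc.mul_right, ?_, ?_, ?_, ?_⟩
  · intro y hy
    simp [hχs y (by linarith)]
  · refine ContDiff.mul (ContDiff.neg ?_) hws
    rw [contDiff_iff_contDiffAt]
    intro y
    by_cases hy : y = 0
    · subst hy
      have : (fun y => e y * cDeriv a b χ y) =ᶠ[nhds 0] fun _ => 0 := by
        filter_upwards [hdχ0] with y hy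
        simp [hy]
      exact contDiffAt_const.congr_of_eventuallyEq this
    · exact (hes.contDiffAt (isOpen_compl_singleton.mem_nhds hy)).mul hdχ.contDiffAt
  · intro y hy
    simp [hdχs y hy]
  · intro f hf
    have hd : ∀ {u : E → ℂ}, ContDiff ℝ ∞ u → Differentiable ℝ u := fun hu =>
      hu.differentiable (by simp)
    have h1 := hfs (fun y => χ y * (w y * f y)) (hχ.mul (hws.mul hf)) hχc.mul_right
    have hχ0 : χ 0 = 1 := by
      have : χ' 0 = 1 := χ'.eventuallyEq_one.self_of_nhds
      simp [χ, this]
    have hw0 : w 0 = 1 := by simp [hw]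
    rw [hχ0, hw0, one_mul, one_mul] at h1
    have h2 : ∀ y, e y * cDeriv a b (fun y => χ y * (w y * f y)) y =
        e y * (cDeriv a b χ y * (w y * f y)) +
          e y * (χ y * (w y * (s * f y + cDeriv a b f y))) := fun y => by
      rw [cDeriv_mul (hd hχ y) (hd (hws.mul hf) y), cDeriv_mul (hd hws y) (hd hf y),
        cDeriv_exp l hl]
      ring
    have hdf : Continuous (cDeriv a b f) := (contDiff_cDeriv hf).continuous
    have i1 : Integrable (fun y => e y * (cDeriv a b χ y * (w y * f y))) μ :=
      hint (fun y => cDeriv a b χ y * (w y * f y))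
        (hdχ.continuous.mul (hws.continuous.mul hf.continuous)) hdχc.mul_right
    have i2 : Integrable (fun y => e y * (χ y * (w y * (s * f y + cDeriv a b f y)))) μ :=
      hint (fun y => χ y * (w y * (s * f y + cDeriv a b f y))) (hχ.continuous.mul
        (hws.continuous.mul ((continuous_const.mul hf.continuous).add hdf))) hχc.mul_right
    rw [integral_congr_ae (Filter.Eventually.of_forall h2), integral_add i1 i2] at h1
    have h3 : ∫ y, -(e y * cDeriv a b χ y) * w y * f y ∂μ =
        -∫ y, e y * (cDeriv a b χ y * (w y * f y)) ∂μ := by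
      rw [← integral_neg]
      exact integral_congr_ae (Filter.Eventually.of_forall fun y => by ring)
    have h4 : ∫ y, e y * (χ y * w y) * (-cDeriv a b f y - s * f y) ∂μ =
        -∫ y, e y * (χ y * (w y * (s * f y + cDeriv a b f y))) ∂μ := by
      rw [← integral_neg]
      exact integral_congr_ae (Filter.Eventually.of_forall fun y => by ring)
    rw [h3, h4]
    linear_combination h1

end ComplexVectorField

/-! ### Fundamental solutions on the line and in the plane -/

/-- The Heaviside function; the identity is the fundamental theorem of calculus on the positive
half-line. -/
theorem hasFundamentalSolution_real : HasFundamentalSolution (volume : Measure ℝ) 1 0 := by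
  refine ⟨Set.indicator (Set.Ioi 0) fun _ => 1, ?_, ?_, ?_⟩
  · exact (continuous_const.locallyIntegrable).indicator measurableSet_Ioi
  · refine fun x hx => ContDiffAt.contDiffWithinAt ?_
    rcases lt_or_gt_of_ne hx with h | h
    · refine (contDiffAt_const (c := (0 : ℂ))).congr_of_eventuallyEq ?_
      filter_upwards [gt_mem_nhds h] with y hy
      exact Set.indicator_of_notMem (by simpa using hy.le) _
    · refine (contDiffAt_const (c := (1 : ℂ))).congr_of_eventuallyEq ?_
      filter_upwards [lt_mem_nhds h] with y hy
      exact Set.indicator_of_mem (by simpa using hy) _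
  · intro g hg hc
    have h1 : ∀ y, Set.indicator (Set.Ioi (0 : ℝ)) (fun _ => (1 : ℂ)) y * cDeriv 1 0 g y =
        Set.indicator (Set.Ioi 0) (deriv g) y := fun y => by
      simp [cDeriv, Set.indicator_apply]
    simp only [h1]
    rw [integral_indicator measurableSet_Ioi]
    exact hc.integral_Ioi_deriv_eq (hg.of_le (by simp)) 0

open Complex in
-- The field `1 + i I` is `∂_x + i ∂_y`, twice the Cauchy–Riemann operator, with fundamental
-- solution `1 / (2πz)`. In polar coordinates the Jacobian `r` cancels the singularity and the
-- integrand splits into a radial and an angular derivative.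
theorem hasFundamentalSolution_complex :
    HasFundamentalSolution (volume : Measure ℂ) 1 Complex.I := by
  refine ⟨fun z => (2 * Real.pi * z)⁻¹, ?_, ?_, ?_⟩
  · refine locallyIntegrable_of_norm_le_rpow (C := (2 * Real.pi)⁻¹) (α := 1) (by simp) (by simp)
      (Filter.Eventually.of_forall fun z => ?_) (by fun_prop)
    rw [Real.rpow_neg_one, norm_inv, norm_mul, mul_inv]
    simp [abs_of_pos Real.pi_pos]
  · refine ContDiffOn.inv (by fun_prop) fun z hz => ?_
    exact mul_ne_zero (by simp [Real.pi_ne_zero]) hz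
  · intro g hg hc
    obtain ⟨R, hR⟩ := hc.isCompact.isBounded.subset_closedBall 0
    have hdiff : Differentiable ℝ g := hg.differentiable (by simp)
    have hcf : Continuous (fderiv ℝ g) := hg.continuous_fderiv (by simp)
    let pt : ℝ × ℝ → ℂ := fun q => q.1 * Complex.exp (q.2 * I)
    have hpt : Continuous pt := by fun_prop
    let A : ℝ × ℝ → ℂ := fun q => fderiv ℝ g (pt q) (Complex.exp (q.2 * I))
    let B : ℝ × ℝ → ℂ := fun q => fderiv ℝ g (pt q) (Complex.exp (q.2 * I) * I)
    have hA : Continuous A := (hcf.comp hpt).clm_apply (by fun_prop)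
    have hB : Continuous B := (hcf.comp hpt).clm_apply (by fun_prop)
    have hzero : ∀ q : ℝ × ℝ, R < q.1 → fderiv ℝ g (pt q) = 0 := by
      intro q hq
      refine image_eq_zero_of_notMem_tsupport fun h => ?_
      have h1 := hR (tsupport_fderiv_subset ℝ h)
      rw [mem_closedBall_zero_iff, norm_mul, Complex.norm_exp_ofReal_mul_I, mul_one,
        Complex.norm_real] at h1
      exact absurd (h1.trans_lt' (hq.trans_le (le_abs_self _))) (lt_irrefl _)
    have hInt : ∀ F : ℝ × ℝ → ℂ, Continuous F → (∀ q : ℝ × ℝ, R < q.1 → F q = 0) →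
        IntegrableOn F (Set.Ioi 0 ×ˢ Set.Ioo (-Real.pi) Real.pi) (volume.prod volume) := by
      intro F hF hF0
      have h1 : IntegrableOn F (Set.Icc 0 R ×ˢ Set.Icc (-Real.pi) Real.pi)
          (volume.prod volume) :=
        hF.continuousOn.integrableOn_compact (isCompact_Icc.prod isCompact_Icc)
      refine h1.of_forall_sdiff_eq_zero (measurableSet_Ioi.prod measurableSet_Ioo) ?_
      rintro ⟨r, t⟩ ⟨⟨hr, ht⟩, hnot⟩
      refine hF0 _ ?_
      by_contra hle
      exact hnot ⟨⟨le_of_lt hr, not_lt.1 hle⟩, ⟨ht.1.le, ht.2.le⟩⟩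
    have hAi := hInt A hA fun q hq => by simp [A, hzero q hq]
    have hBi := hInt B hB fun q hq => by simp [B, hzero q hq]
    rw [← Complex.integral_comp_polarCoord_symm, polarCoord_target]
    have h1 : ∀ q ∈ Set.Ioi (0 : ℝ) ×ˢ Set.Ioo (-Real.pi) Real.pi,
        q.1 • ((2 * Real.pi * Complex.polarCoord.symm q)⁻¹ *
          cDeriv 1 I g (Complex.polarCoord.symm q)) = (2 * Real.pi : ℂ)⁻¹ * (A q + I * B q) := by
      rintro ⟨r, t⟩ ⟨hr, -⟩
      have hr' : (r : ℂ) ≠ 0 := by exact_mod_cast (ne_of_gt hr)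
      have hsymm : Complex.polarCoord.symm (r, t) = pt (r, t) := by
        rw [Complex.polarCoord_symm_apply]
        simp only [pt, Complex.exp_mul_I]
        simp
      rw [hsymm]
      have hlin : ∀ v : ℂ, fderiv ℝ g (pt (r, t)) v =
          v.re * fderiv ℝ g (pt (r, t)) 1 + v.im * fderiv ℝ g (pt (r, t)) I := fun v => by
        have hv : v = v.re • (1 : ℂ) + v.im • I := by
          simp [Complex.re_add_im]
        conv_lhs => rw [hv]
        rw [map_add, map_smul, map_smul]
        simp
      have hexp : Complex.exp (t * I) ≠ 0 := Complex.exp_ne_zero _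
      have hre : (Complex.exp (t * I)).re = Real.cos t := Complex.exp_ofReal_mul_I_re t
      have him : (Complex.exp (t * I)).im = Real.sin t := Complex.exp_ofReal_mul_I_im t
      have hinv : (Complex.exp (t * I))⁻¹ = Complex.cos t - Complex.sin t * I := by
        rw [← Complex.exp_neg, ← neg_mul, Complex.exp_mul_I]
        simp [sub_eq_add_neg]
      simp only [A, B, cDeriv]
      rw [hlin (Complex.exp (t * I)), hlin (Complex.exp (t * I) * I)]
      simp only [Complex.mul_re, Complex.mul_im, Complex.I_re, Complex.I_im, hre, him]
      generalize fderiv ℝ g (pt (r, t)) 1 = u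
      generalize fderiv ℝ g (pt (r, t)) I = v
      have hpt' : pt (r, t) = r * Complex.exp (t * I) := rfl
      rw [hpt', Complex.real_smul, mul_inv, mul_inv (r : ℂ), hinv]
      push_cast
      field_simp
      linear_combination (-Complex.sin t * v) * Complex.I_sq
    rw [setIntegral_congr_fun (measurableSet_Ioi.prod measurableSet_Ioo) h1,
      integral_const_mul]
    change (2 * Real.pi : ℂ)⁻¹ * ∫ q in Set.Ioi (0 : ℝ) ×ˢ Set.Ioo (-Real.pi) Real.pi,
      (A q + I * B q) ∂(volume.prod volume) = _
    rw [integral_add hAi (hBi.const_mul I), integral_const_mul]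
    -- `B` is `1 / r` times the derivative in the angle, so its integral over a full period is zero.
    have hBint : ∫ q in Set.Ioi (0 : ℝ) ×ˢ Set.Ioo (-Real.pi) Real.pi, B q
        ∂(volume.prod volume) = 0 := by
      rw [setIntegral_prod _ hBi]
      refine setIntegral_eq_zero_of_forall_eq_zero fun r hr => ?_
      have hr' : (r : ℂ) ≠ 0 := by exact_mod_cast (ne_of_gt hr)
      have hder : ∀ t : ℝ, HasDerivAt (fun t : ℝ => (r : ℂ)⁻¹ * g (pt (r, t))) (B (r, t)) t := by
        intro t
        have hp : HasDerivAt (fun t : ℝ => pt (r, t)) (r * (Complex.exp (t * I) * I)) t := by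
          have : HasDerivAt (fun t : ℝ => (t : ℂ) * I) (1 * I) t :=
            (Complex.ofRealCLM.hasDerivAt (x := t)).mul_const I
          rw [one_mul] at this
          exact this.cexp.const_mul (r : ℂ)
        have h2 := ((hdiff (pt (r, t))).hasFDerivAt.comp_hasDerivAt t hp).const_mul (r : ℂ)⁻¹
        have h3 : (r : ℂ)⁻¹ * fderiv ℝ g (pt (r, t)) (r * (Complex.exp (t * I) * I)) =
            B (r, t) := by
          rw [← Complex.real_smul, map_smul, Complex.real_smul, inv_mul_cancel_left₀ hr']
        rw [h3] at h2
        exact h2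
      rw [← integral_Ioc_eq_integral_Ioo,
        ← intervalIntegral.integral_of_le (by linarith [Real.pi_pos]),
        intervalIntegral.integral_eq_sub_of_hasDerivAt (fun t _ => hder t)
          ((by fun_prop : Continuous fun t => B (r, t)).intervalIntegrable _ _)]
      have : pt (r, Real.pi) = pt (r, -Real.pi) := by
        simp [pt, Complex.exp_mul_I]
      rw [this, sub_self]
    -- `A` is the radial derivative: each ray contributes `-g 0`, and the rays have total angle
    -- `2π`.
    have hAint : ∫ q in Set.Ioi (0 : ℝ) ×ˢ Set.Ioo (-Real.pi) Real.pi, A q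
        ∂(volume.prod volume) = -(2 * Real.pi * g 0) := by
      rw [← setIntegral_prod_swap, setIntegral_prod (fun q => A q.swap) hAi.swap]
      have hin : ∀ t : ℝ, ∫ r in Set.Ioi (0 : ℝ), A (r, t) = -g 0 := by
        intro t
        have hder : ∀ r : ℝ, HasDerivAt (fun r : ℝ => g (pt (r, t))) (A (r, t)) r := by
          intro r
          have hp : HasDerivAt (fun r : ℝ => pt (r, t)) (Complex.exp (t * I)) r := by
            simpa using (Complex.ofRealCLM.hasDerivAt (x := r)).mul_const (Complex.exp (t * I))
          exact (hdiff (pt (r, t))).hasFDerivAt.comp_hasDerivAt r hp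
        have hcs : HasCompactSupport fun r : ℝ => g (pt (r, t)) := by
          refine HasCompactSupport.of_support_subset_isCompact (isCompact_closedBall 0 R) ?_
          intro r hr
          have h2 := hR (subset_tsupport g hr)
          rw [mem_closedBall_zero_iff, norm_mul, Complex.norm_exp_ofReal_mul_I, mul_one,
            Complex.norm_real] at h2
          simpa using h2
        have hsm : ContDiff ℝ 1 fun r : ℝ => g (pt (r, t)) := by
          refine (hg.of_le (by simp)).comp ?_
          show ContDiff ℝ 1 fun r : ℝ => (r : ℂ) * Complex.exp (t * I)
          exact (Complex.ofRealCLM.contDiff).mul contDiff_const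
        have h3 := hcs.integral_Ioi_deriv_eq hsm 0
        rw [show deriv (fun r : ℝ => g (pt (r, t))) = fun r => A (r, t) from
          funext fun r => (hder r).deriv] at h3
        rw [h3]
        simp [pt]
      simp only [Prod.swap_prod_mk, hin]
      rw [setIntegral_const]
      simp only [Real.volume_real_Ioo_of_le
        (by linarith [Real.pi_pos] : -Real.pi ≤ Real.pi), Complex.real_smul]
      push_cast
      ring
    rw [hAint, hBint]
    have : (Real.pi : ℂ) ≠ 0 := by exact_mod_cast Real.pi_ne_zero
    field_simp
    ring

/-! ### Products of first-order operators along one direction -/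

section ConstOp

variable {E : Type*} [NormedAddCommGroup E] [NormedSpace ℝ E]

/-- The operator `∏_{s ∈ S} (∂ - s)` where `∂` is the derivative along `a + i b`. -/
noncomputable def constOp (a b : E) : List ℂ → (E → ℂ) → (E → ℂ)
  | [], f => f
  | s :: S, f => constOp a b S fun x => cDeriv a b f x - s * f x

variable {a b : E} {f g : E → ℂ} {S T : List ℂ}

@[simp] theorem constOp_nil : constOp a b [] f = f := rfl

theorem constOp_cons (s : ℂ) :
    constOp a b (s :: S) f = constOp a b S fun x => cDeriv a b f x - s * f x := rfl

theorem contDiff_cDeriv_sub (hf : ContDiff ℝ ∞ f) (s : ℂ) :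
    ContDiff ℝ ∞ fun x => cDeriv a b f x - s * f x :=
  (contDiff_cDeriv hf).sub (contDiff_const.mul hf)

theorem tsupport_cDeriv_sub (s : ℂ) :
    tsupport (fun x => cDeriv a b f x - s * f x) ⊆ tsupport f := by
  refine closure_minimal (fun x hx => ?_) (isClosed_tsupport _)
  by_contra h
  refine hx ?_
  show cDeriv a b f x - s * f x = 0
  rw [image_eq_zero_of_notMem_tsupport fun h' => h (tsupport_cDeriv h'),
    image_eq_zero_of_notMem_tsupport h, mul_zero, sub_zero]

theorem hasCompactSupport_cDeriv_sub (hf : HasCompactSupport f) (s : ℂ) :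
    HasCompactSupport fun x => cDeriv a b f x - s * f x :=
  hf.of_isClosed_subset (isClosed_tsupport _) (tsupport_cDeriv_sub s)

theorem contDiff_constOp (hf : ContDiff ℝ ∞ f) : ContDiff ℝ ∞ (constOp a b S f) := by
  induction S generalizing f with
  | nil => exact hf
  | cons s S ih => exact ih (contDiff_cDeriv_sub hf s)

theorem tsupport_constOp : tsupport (constOp a b S f) ⊆ tsupport f := by
  induction S generalizing f with
  | nil => exact subset_rfl
  | cons s S ih => exact ih.trans (tsupport_cDeriv_sub s)

theorem hasCompactSupport_constOp (hf : HasCompactSupport f) :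
    HasCompactSupport (constOp a b S f) :=
  hf.of_isClosed_subset (isClosed_tsupport _) tsupport_constOp

theorem cDeriv_sub_add (hf : ContDiff ℝ ∞ f) (hg : ContDiff ℝ ∞ g) (s : ℂ) :
    (fun x => cDeriv a b (fun y => f y + g y) x - s * (f x + g x)) =
      fun x => (cDeriv a b f x - s * f x) + (cDeriv a b g x - s * g x) := by
  funext x
  rw [cDeriv_add ((hf.differentiable (by simp)) x) ((hg.differentiable (by simp)) x)]
  ring

theorem constOp_add (hf : ContDiff ℝ ∞ f) (hg : ContDiff ℝ ∞ g) :
    constOp a b S (fun x => f x + g x) = fun x => constOp a b S f x + constOp a b S g x := by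
  induction S generalizing f g with
  | nil => rfl
  | cons s S ih =>
    rw [constOp_cons, cDeriv_sub_add hf hg, ih (contDiff_cDeriv_sub hf s) (contDiff_cDeriv_sub hg s)]
    rfl

theorem constOp_const_mul (c : ℂ) (hf : ContDiff ℝ ∞ f) :
    constOp a b S (fun x => c * f x) = fun x => c * constOp a b S f x := by
  induction S generalizing f with
  | nil => rfl
  | cons s S ih =>
    have h : (fun x => cDeriv a b (fun y => c * f y) x - s * (c * f x)) =
        fun x => c * (cDeriv a b f x - s * f x) := by
      funext x
      rw [cDeriv_const_mul c ((hf.differentiable (by simp)) x)]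
      ring
    rw [constOp_cons, h, ih (contDiff_cDeriv_sub hf s)]
    rfl

theorem cDeriv_sub_comm (hf : ContDiff ℝ ∞ f) (s t : ℂ) :
    (fun x => cDeriv a b (fun y => cDeriv a b f y - s * f y) x - t * (cDeriv a b f x - s * f x)) =
      fun x => cDeriv a b (fun y => cDeriv a b f y - t * f y) x -
        s * (cDeriv a b f x - t * f x) := by
  have h : ∀ r x, cDeriv a b (fun y => cDeriv a b f y - r * f y) x =
      cDeriv a b (cDeriv a b f) x - r * cDeriv a b f x := by
    intro r x
    have hd := (hf.differentiable (by simp)) x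
    have hdd := ((contDiff_cDeriv (a := a) (b := b) hf).differentiable (by simp)) x
    have h1 := cDeriv_add (a := a) (b := b) hdd (hd.const_mul (-r))
    rw [cDeriv_const_mul _ hd] at h1
    simpa [sub_eq_add_neg] using h1
  funext x
  rw [h, h]
  ring

theorem constOp_comm (hf : ContDiff ℝ ∞ f) (s : ℂ) :
    (fun x => cDeriv a b (constOp a b S f) x - s * constOp a b S f x) =
      constOp a b (s :: S) f := by
  induction S generalizing f with
  | nil => rfl
  | cons t S ih =>
    rw [constOp_cons, ih (contDiff_cDeriv_sub hf t), constOp_cons, constOp_cons, constOp_cons,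
      cDeriv_sub_comm hf]

theorem constOp_append : constOp a b (S ++ T) f = constOp a b T (constOp a b S f) := by
  induction S generalizing f with
  | nil => rfl
  | cons s S ih => exact ih

theorem constOp_constOp_comm (hf : ContDiff ℝ ∞ f) :
    constOp a b T (constOp a b S f) = constOp a b S (constOp a b T f) := by
  induction T generalizing f with
  | nil => rfl
  | cons t T ih =>
    rw [constOp_cons, constOp_comm hf, constOp_cons, ih (contDiff_cDeriv_sub hf t), constOp_cons]

theorem constOp_eq_zero_on {O : Set E} (hO : IsOpen O) (h : ∀ x ∈ O, f x = 0) :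
    ∀ x ∈ O, constOp a b S f x = 0 := by
  induction S generalizing f with
  | nil => exact h
  | cons s S ih =>
    refine ih fun x hx => ?_
    have hev : f =ᶠ[nhds x] fun _ => 0 := Filter.eventuallyEq_of_mem (hO.mem_nhds hx) h
    rw [cDeriv_congr hev, h x hx]
    simp [cDeriv]

theorem constOp_exp (l : E →L[ℝ] ℂ) (hl : l a + Complex.I * l b = 1) (κ : ℂ) :
    constOp a b S (fun y => Complex.exp (κ * l y)) =
      fun y => (S.map fun s => κ - s).prod * Complex.exp (κ * l y) := by
  induction S with
  | nil => simp
  | cons s S ih =>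
    have h : (fun x => cDeriv a b (fun y => Complex.exp (κ * l y)) x -
        s * Complex.exp (κ * l x)) = fun x => (κ - s) * Complex.exp (κ * l x) := by
      funext x
      rw [cDeriv_exp l hl]
      ring
    rw [constOp_cons, h, constOp_const_mul _ (contDiff_exp_mul_clm l κ), ih]
    simp [mul_assoc]

/-- Products of solutions of two constant coefficient equations in the same direction solve a third
one. -/
theorem exists_constOp_mul (a b : E) (S T : List ℂ) : ∃ Q : List ℂ, ∀ f g : E → ℂ,
    ContDiff ℝ ∞ f → ContDiff ℝ ∞ g → ∀ O : Set E, IsOpen O →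
      (∀ x ∈ O, constOp a b S f x = 0) → (∀ x ∈ O, constOp a b T g x = 0) →
        ∀ x ∈ O, constOp a b Q (fun y => f y * g y) x = 0 := by
  induction S generalizing T with
  | nil => exact ⟨[], fun f g _ _ O _ hS _ x hx => by simp [show f x = 0 from hS x hx]⟩
  | cons s S ihS =>
    induction T with
    | nil => exact ⟨[], fun f g _ _ O _ _ hT x hx => by simp [show g x = 0 from hT x hx]⟩
    | cons t T ihT =>
      obtain ⟨Q₁, h₁⟩ := ihS (t :: T)
      obtain ⟨Q₂, h₂⟩ := ihT
      -- Leibniz: `(∂ - (s + t))(f g) = (∂ f - s f) g + f (∂ g - t g)`. Each summand has one factor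
      -- solving a shorter equation, so `Q₁` annihilates the first and `Q₂` the second. As the
      -- operators commute, their composition annihilates both.
      refine ⟨(s + t) :: (Q₁ ++ Q₂), fun f g hf hg O hO hS hT x hx => ?_⟩
      set f' := fun x => cDeriv a b f x - s * f x with hf'
      set g' := fun x => cDeriv a b g x - t * g x with hg'
      have hfs : ContDiff ℝ ∞ f' := contDiff_cDeriv_sub hf s
      have hgs : ContDiff ℝ ∞ g' := contDiff_cDeriv_sub hg t
      have hsplit : (fun x => cDeriv a b (fun y => f y * g y) x - (s + t) * (f x * g x)) =
          fun x => f' x * g x + f x * g' x := by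
        funext x
        rw [cDeriv_mul ((hf.differentiable (by simp)) x) ((hg.differentiable (by simp)) x)]
        simp only [hf', hg']
        ring
      have e₁ := h₁ f' g hfs hg O hO hS hT
      have e₂ := h₂ f g' hf hgs O hO hS hT
      rw [constOp_cons, hsplit, constOp_add (hfs.mul hg) (hf.mul hgs), constOp_append,
        constOp_append, constOp_constOp_comm (hf.mul hgs)]
      show constOp a b Q₂ _ x + constOp a b Q₁ _ x = 0
      rw [constOp_eq_zero_on hO e₁ x hx, constOp_eq_zero_on hO e₂ x hx, add_zero]

section Integral

variable [FiniteDimensional ℝ E] [MeasurableSpace E] [BorelSpace E] {μ : Measure E}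
  [μ.IsAddHaarMeasure]

theorem integral_mul_cDeriv (hf : ContDiff ℝ ∞ f) (hg : ContDiff ℝ ∞ g)
    (hc : HasCompactSupport f ∨ HasCompactSupport g) :
    ∫ x, f x * cDeriv a b g x ∂μ = ∫ x, cDeriv (-a) (-b) f x * g x ∂μ := by
  have hi : ∀ u v : E → ℂ, Continuous u → Continuous v →
      (HasCompactSupport u ∨ HasCompactSupport v) → Integrable (fun x => u x * v x) μ := by
    intro u v hu hv h
    refine (hu.mul hv).integrable_of_hasCompactSupport ?_
    rcases h with h | h
    · exact h.mul_right
    · exact h.mul_left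
  have hc' : ∀ {u : E → ℂ} (v : E), HasCompactSupport u →
      HasCompactSupport fun x => fderiv ℝ u x v := fun v hu =>
    hu.of_isClosed_subset (isClosed_tsupport _) (tsupport_fderiv_apply_subset ℝ _)
  have i1 : ∀ v, Integrable (fun x => f x * fderiv ℝ g x v) μ := fun v =>
    hi _ _ hf.continuous (contDiff_fderiv_apply_const hg v).continuous
      (hc.imp id (hc' v))
  have i2 : ∀ v, Integrable (fun x => fderiv ℝ f x v * g x) μ := fun v =>
    hi _ _ (contDiff_fderiv_apply_const hf v).continuous hg.continuous
      (hc.imp (hc' v) id)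
  have key : ∀ v, ∫ x, f x * fderiv ℝ g x v ∂μ = -∫ x, fderiv ℝ f x v * g x ∂μ := fun v =>
    integral_mul_fderiv_eq_neg_fderiv_mul_of_integrable (i2 v) (i1 v)
      (hi _ _ hf.continuous hg.continuous hc)
      (fun x _ => (hf.differentiable (by simp)) x) (fun x _ => (hg.differentiable (by simp)) x)
  have h1 : ∀ x, f x * cDeriv a b g x =
      f x * fderiv ℝ g x a + Complex.I * (f x * fderiv ℝ g x b) := fun x => by
    simp only [cDeriv]; ring
  have h2 : ∀ x, cDeriv (-a) (-b) f x * g x =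
      -(fderiv ℝ f x a * g x + Complex.I * (fderiv ℝ f x b * g x)) := fun x => by
    simp only [cDeriv, map_neg]; ring
  simp only [h1, h2]
  rw [integral_neg, integral_add (i1 a) ((i1 b).const_mul _),
    integral_add (i2 a) ((i2 b).const_mul _), integral_const_mul, integral_const_mul, key, key]
  ring

theorem integral_mul_cDeriv_sub (hf : ContDiff ℝ ∞ f) (hg : ContDiff ℝ ∞ g)
    (hc : HasCompactSupport f ∨ HasCompactSupport g) (s : ℂ) :
    ∫ x, f x * (cDeriv a b g x - s * g x) ∂μ = ∫ x, (cDeriv (-a) (-b) f x - s * f x) * g x ∂μ := by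
  have hi : ∀ u v : E → ℂ, Continuous u → Continuous v →
      (HasCompactSupport u ∨ HasCompactSupport v) → Integrable (fun x => u x * v x) μ := by
    intro u v hu hv h
    refine (hu.mul hv).integrable_of_hasCompactSupport ?_
    rcases h with h | h
    · exact h.mul_right
    · exact h.mul_left
  have h1 : ∀ x, f x * (cDeriv a b g x - s * g x) = f x * cDeriv a b g x - s * (f x * g x) :=
    fun x => by ring
  have h2 : ∀ x, (cDeriv (-a) (-b) f x - s * f x) * g x =
      cDeriv (-a) (-b) f x * g x - s * (f x * g x) := fun x => by ring
  have hfg := (hi _ _ hf.continuous hg.continuous hc).const_mul s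
  simp only [h1, h2]
  rw [integral_sub (hi _ _ hf.continuous (contDiff_cDeriv hg).continuous
      (hc.imp id fun h => h.of_isClosed_subset (isClosed_tsupport _) tsupport_cDeriv)) hfg,
    integral_sub (hi _ _ (contDiff_cDeriv hf).continuous hg.continuous
      (hc.imp (fun h => h.of_isClosed_subset (isClosed_tsupport _) tsupport_cDeriv) id)) hfg,
    integral_mul_cDeriv hf hg hc]

/-- The transpose of `∂ - s` is `-∂ - s`, so transposing reverses the direction and keeps the list
`S`. -/
theorem integral_mul_constOp (hf : ContDiff ℝ ∞ f) (hg : ContDiff ℝ ∞ g)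
    (hc : HasCompactSupport f ∨ HasCompactSupport g) :
    ∫ x, f x * constOp a b S g x ∂μ = ∫ x, constOp (-a) (-b) S f x * g x ∂μ := by
  induction S generalizing g with
  | nil => rfl
  | cons s S ih =>
    rw [constOp_cons, ih (contDiff_cDeriv_sub hg s)
      (hc.imp id fun h => hasCompactSupport_cDeriv_sub h s),
      integral_mul_cDeriv_sub (contDiff_constOp hf) hg (hc.imp hasCompactSupport_constOp id),
      ← constOp_comm hf]

end Integral

end ConstOp

set_option linter.unusedSectionVars false

/-! ### Averages of translates -/

section ShiftAvg

variable {V X : Type*} [NormedAddCommGroup V] [NormedSpace ℝ V] [FiniteDimensional ℝ V]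
  [MeasurableSpace V] [BorelSpace V] {μ : Measure V}
  [NormedAddCommGroup X] [NormedSpace ℝ X] [FiniteDimensional ℝ X]
  {ι : V →L[ℝ] X} {G : V → ℂ} {φ : X → ℂ}

/-- The average `∫ G(y) φ(x + ι y) dy` of translates of `φ`. -/
noncomputable def shiftAvg (μ : Measure V) (ι : V →L[ℝ] X) (G : V → ℂ) (φ : X → ℂ) : X → ℂ :=
  fun x => ∫ y, G y * φ (x + ι y) ∂μ

theorem integrable_mul_shift (hG : Integrable G μ) (hφ : Continuous φ)
    (hc : HasCompactSupport φ) (x : X) : Integrable (fun y => G y * φ (x + ι y)) μ := by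
  obtain ⟨C, hC⟩ := hc.exists_bound_of_continuous hφ
  exact hG.mul_bdd (c := C) (by fun_prop) (Filter.Eventually.of_forall fun y => hC _)

theorem hasFDerivAt_shiftAvg (hG : Integrable G μ) (hφ : ContDiff ℝ ∞ φ)
    (hc : HasCompactSupport φ) (x : X) :
    HasFDerivAt (shiftAvg μ ι G φ) (∫ y, G y • fderiv ℝ φ (x + ι y) ∂μ) x := by
  have hcf : Continuous (fderiv ℝ φ) := hφ.continuous_fderiv (by simp)
  obtain ⟨C, hC⟩ := (hc.fderiv (𝕜 := ℝ)).exists_bound_of_continuous hcf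
  refine hasFDerivAt_integral_of_dominated_of_fderiv_le (𝕜 := ℝ) (s := Set.univ)
    (F := fun x y => G y * φ (x + ι y)) (F' := fun x y => G y • fderiv ℝ φ (x + ι y))
    (bound := fun y => ‖G y‖ * C) Filter.univ_mem
    (Filter.Eventually.of_forall fun z => (integrable_mul_shift hG hφ.continuous hc z).1)
    (integrable_mul_shift hG hφ.continuous hc x) ?_ ?_ (hG.norm.mul_const C) ?_
  · exact hG.1.smul (by fun_prop : Continuous fun y => fderiv ℝ φ (x + ι y)).aestronglyMeasurable
  · refine Filter.Eventually.of_forall fun y z _ => ?_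
    rw [norm_smul]
    exact mul_le_mul_of_nonneg_left (hC _) (norm_nonneg _)
  · refine Filter.Eventually.of_forall fun y z _ => ?_
    have h1 : HasFDerivAt (fun z => φ (z + ι y)) (fderiv ℝ φ (z + ι y)) z := by
      have h2 := ((hφ.differentiable (by simp)) (z + ι y)).hasFDerivAt
      have h3 : HasFDerivAt (fun z => z + ι y) (ContinuousLinearMap.id ℝ X) z :=
        (hasFDerivAt_id z).add_const _
      exact h2.comp z h3
    exact h1.const_mul (G y)

theorem fderiv_shiftAvg_apply (hG : Integrable G μ) (hφ : ContDiff ℝ ∞ φ)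
    (hc : HasCompactSupport φ) (x v : X) :
    fderiv ℝ (shiftAvg μ ι G φ) x v = shiftAvg μ ι G (fun z => fderiv ℝ φ z v) x := by
  have hcf : Continuous (fderiv ℝ φ) := hφ.continuous_fderiv (by simp)
  obtain ⟨C, hC⟩ := (hc.fderiv (𝕜 := ℝ)).exists_bound_of_continuous hcf
  have hi : Integrable (fun y => G y • fderiv ℝ φ (x + ι y)) μ :=
    hG.smul_bdd C
      (by fun_prop : Continuous fun y => fderiv ℝ φ (x + ι y)).aestronglyMeasurable
      (Filter.Eventually.of_forall fun y => hC _)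
  rw [(hasFDerivAt_shiftAvg hG hφ hc x).fderiv, ContinuousLinearMap.integral_apply hi]
  rfl

/-- Every derivative falls on `φ` and yields another average of the same kind, so the weight `G`
only has to be integrable. -/
theorem contDiff_shiftAvg (hG : Integrable G μ) (hφ : ContDiff ℝ ∞ φ)
    (hc : HasCompactSupport φ) : ContDiff ℝ ∞ (shiftAvg μ ι G φ) := by
  rw [contDiff_infty]
  intro n
  induction n generalizing φ with
  | zero =>
    have : Differentiable ℝ (shiftAvg μ ι G φ) := fun x =>
      (hasFDerivAt_shiftAvg hG hφ hc x).differentiableAt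
    exact_mod_cast contDiff_zero.2 this.continuous
  | succ n ih =>
    push_cast
    rw [contDiff_succ_iff_fderiv_apply]
    refine ⟨fun x => (hasFDerivAt_shiftAvg hG hφ hc x).differentiableAt, by simp, fun v => ?_⟩
    simp only [fderiv_shiftAvg_apply hG hφ hc]
    exact ih (contDiff_fderiv_apply_const hφ v)
      (hc.of_isClosed_subset (isClosed_tsupport _) (tsupport_fderiv_apply_subset ℝ _))

theorem cDeriv_sub_shiftAvg (hG : Integrable G μ) (hφ : ContDiff ℝ ∞ φ)
    (hc : HasCompactSupport φ) (a b : X) (s : ℂ) :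
    (fun x => cDeriv a b (shiftAvg μ ι G φ) x - s * shiftAvg μ ι G φ x) =
      shiftAvg μ ι G fun x => cDeriv a b φ x - s * φ x := by
  funext x
  have hi : ∀ v, Integrable (fun y => G y * fderiv ℝ φ (x + ι y) v) μ := fun v =>
    integrable_mul_shift (φ := fun z => fderiv ℝ φ z v) hG
      (contDiff_fderiv_apply_const hφ v).continuous
      (hc.of_isClosed_subset (isClosed_tsupport _) (tsupport_fderiv_apply_subset ℝ _)) x
  simp only [cDeriv]
  rw [fderiv_shiftAvg_apply hG hφ hc, fderiv_shiftAvg_apply hG hφ hc]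
  have h : ∀ y, G y * (fderiv ℝ φ (x + ι y) a + Complex.I * fderiv ℝ φ (x + ι y) b -
      s * φ (x + ι y)) = G y * fderiv ℝ φ (x + ι y) a +
        (Complex.I * (G y * fderiv ℝ φ (x + ι y) b) - s * (G y * φ (x + ι y))) := fun y => by ring
  simp only [shiftAvg, h]
  have i3 := (integrable_mul_shift (ι := ι) hG hφ.continuous hc x).const_mul s
  have i4 : Integrable (fun y => Complex.I * (G y * fderiv ℝ φ (x + ι y) b) -
      s * (G y * φ (x + ι y))) μ := ((hi b).const_mul _).sub i3
  rw [integral_add (hi a) i4, integral_sub ((hi b).const_mul _) i3,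
    integral_const_mul, integral_const_mul]
  ring

theorem constOp_shiftAvg (hG : Integrable G μ) (hφ : ContDiff ℝ ∞ φ)
    (hc : HasCompactSupport φ) (a b : X) (S : List ℂ) :
    constOp a b S (shiftAvg μ ι G φ) = shiftAvg μ ι G (constOp a b S φ) := by
  induction S generalizing φ with
  | nil => rfl
  | cons s S ih =>
    rw [constOp_cons, cDeriv_sub_shiftAvg hG hφ hc, ih (contDiff_cDeriv_sub hφ s)
      (hasCompactSupport_cDeriv_sub hc s), constOp_cons]

theorem support_shiftAvg_subset {ε : ℝ} (hGε : ∀ y, ε ≤ ‖y‖ → G y = 0) (hc : HasCompactSupport φ)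
    : HasCompactSupport (shiftAvg μ ι G φ) ∧
      ∀ x ∈ tsupport (shiftAvg μ ι G φ), ∃ y, ‖y‖ ≤ ε ∧ x + ι y ∈ tsupport φ := by
  set K : Set X := (fun q : X × V => q.1 - ι q.2) '' (tsupport φ ×ˢ Metric.closedBall 0 ε) with hK
  have hKc : IsCompact K := by
    have h1 : IsCompact (tsupport φ) := hc
    exact (h1.prod (isCompact_closedBall 0 ε)).image (by fun_prop)
  have hsub : Function.support (shiftAvg μ ι G φ) ⊆ K := by
    intro x hx
    by_contra hxK
    refine hx (integral_eq_zero_of_ae (Filter.Eventually.of_forall fun y => ?_))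
    by_cases hy : ε ≤ ‖y‖
    · simp [hGε y hy]
    · have : x + ι y ∉ tsupport φ := fun h => hxK ⟨(x + ι y, y), ⟨h, by
        simpa using (not_le.1 hy).le⟩, by simp⟩
      simp [image_eq_zero_of_notMem_tsupport this]
  refine ⟨HasCompactSupport.of_support_subset_isCompact hKc hsub, fun x hx => ?_⟩
  obtain ⟨⟨z, y⟩, ⟨hz, hy⟩, rfl⟩ := closure_minimal hsub hKc.isClosed hx
  exact ⟨y, by simpa using hy, by simpa using hz⟩

theorem cDeriv_comp_shift (hφ : ContDiff ℝ ∞ φ) (a b : V) (x : X) (y : V) :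
    cDeriv a b (fun y => φ (x + ι y)) y = cDeriv (ι a) (ι b) φ (x + ι y) := by
  have h2 := ((hφ.differentiable (by simp)) (x + ι y)).hasFDerivAt
  have h3 : HasFDerivAt (fun y => x + ι y) ι y := ι.hasFDerivAt.const_add x
  have h4 : HasFDerivAt (fun y => φ (x + ι y)) _ y := h2.comp y h3
  simp only [cDeriv, h4.fderiv]
  rfl

theorem constOp_comp_shift (hφ : ContDiff ℝ ∞ φ) (a b : V) (S : List ℂ) (x : X) (y : V) :
    constOp a b S (fun y => φ (x + ι y)) y = constOp (ι a) (ι b) S φ (x + ι y) := by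
  induction S generalizing φ with
  | nil => rfl
  | cons s S ih =>
    rw [constOp_cons, constOp_cons, ← ih (contDiff_cDeriv_sub hφ s)]
    simp only [cDeriv_comp_shift hφ]

theorem shiftAvg_constOp_left [μ.IsAddHaarMeasure] {ρ : V → ℂ} (hρ : ContDiff ℝ ∞ ρ)
    (hρc : HasCompactSupport ρ) (hφ : ContDiff ℝ ∞ φ) (a b : V) (S : List ℂ) :
    shiftAvg μ ι (constOp a b S ρ) φ =
      shiftAvg μ ι ρ (constOp (ι (-a)) (ι (-b)) S φ) := by
  funext x
  have hφx : ContDiff ℝ ∞ fun y => φ (x + ι y) := hφ.comp (contDiff_const.add ι.contDiff)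
  have h := integral_mul_constOp (μ := μ) (a := -a) (b := -b) (S := S) hρ hφx (Or.inl hρc)
  rw [neg_neg, neg_neg] at h
  simp only [shiftAvg]
  rw [← h]
  exact integral_congr_ae (Filter.Eventually.of_forall fun y => by
    simp only [constOp_comp_shift hφ])

end ShiftAvg

set_option linter.unusedSectionVars false

/-! ### Regularity of distributional solutions along slices -/

section Regularity

section Conv

variable {V X : Type*} [NormedAddCommGroup V] [NormedSpace ℝ V] [FiniteDimensional ℝ V]
  [MeasurableSpace V] [BorelSpace V] [SecondCountableTopology V] {μ : Measure V} [SFinite μ]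
  [NormedAddCommGroup X] [NormedSpace ℝ X] [FiniteDimensional ℝ X] [MeasurableSpace X]
  [BorelSpace X] [SecondCountableTopology X] {m : Measure X} [m.IsAddHaarMeasure]
  {ι : V →L[ℝ] X} {ρ : V → ℂ} {u : X → ℂ}

theorem cDeriv_neg_neg {E : Type*} [NormedAddCommGroup E] [NormedSpace ℝ E] (a b : E)
    (f : E → ℂ) (x : E) : cDeriv (-a) (-b) f x = -cDeriv a b f x := by
  simp only [cDeriv, map_neg]
  ring

/-- The shear `(y, x) ↦ (y, x - ι y)` preserves the product measure. -/
theorem integrable_mul_comp_sub (hρ : Integrable ρ μ) (hu : Integrable u m) :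
    Integrable (fun q : V × X => ρ q.1 * u (q.2 - ι q.1)) (μ.prod m) := by
  have hT : MeasurePreserving (fun q : V × X => (q.1, q.2 - ι q.1)) (μ.prod m) (μ.prod m) :=
    (MeasurePreserving.id μ).skew_product (g := fun y x => x - ι y)
      (by fun_prop : Continuous fun q : V × X => q.2 - ι q.1).measurable
      (Filter.Eventually.of_forall fun y => (measurePreserving_sub_right m (ι y)).map_eq)
  have h := hρ.mul_prod hu
  exact (hT.integrable_comp h.aestronglyMeasurable).2 h

theorem integrable_conv (hρ : Integrable ρ μ) (hu : Integrable u m) :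
    Integrable (fun x => ∫ y, ρ y * u (x - ι y) ∂μ) m :=
  (integrable_mul_comp_sub hρ hu).integral_prod_right

/-- By Fubini and translation invariance, averaging of test functions is the transpose of
convolution with `ρ`. -/
theorem integral_conv_mul (hρ : Integrable ρ μ) (hu : Integrable u m) {φ : X → ℂ}
    (hφ : Continuous φ) (hc : HasCompactSupport φ) :
    ∫ x, (∫ y, ρ y * u (x - ι y) ∂μ) * φ x ∂m = ∫ x, u x * shiftAvg μ ι ρ φ x ∂m := by
  obtain ⟨C, hC⟩ := hc.exists_bound_of_continuous hφ
  have h1 : Integrable (fun q : V × X => ρ q.1 * u (q.2 - ι q.1) * φ q.2) (μ.prod m) :=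
    (integrable_mul_comp_sub hρ hu).mul_bdd (c := C) (by fun_prop)
      (Filter.Eventually.of_forall fun q => hC _)
  have h2 : Integrable (fun q : V × X => ρ q.1 * u q.2 * φ (q.2 + ι q.1)) (μ.prod m) :=
    (hρ.mul_prod hu).mul_bdd (c := C) (by fun_prop) (Filter.Eventually.of_forall fun q => hC _)
  calc ∫ x, (∫ y, ρ y * u (x - ι y) ∂μ) * φ x ∂m
      = ∫ x, ∫ y, ρ y * u (x - ι y) * φ x ∂μ ∂m := by
        simp only [integral_mul_const]
    _ = ∫ y, ∫ x, ρ y * u (x - ι y) * φ x ∂m ∂μ := (integral_integral_swap h1).symm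
    _ = ∫ y, ∫ x, ρ y * u x * φ (x + ι y) ∂m ∂μ := by
        refine integral_congr_ae (Filter.Eventually.of_forall fun y => ?_)
        have := integral_add_right_eq_self (μ := m) (fun x => ρ y * u (x - ι y) * φ x) (ι y)
        simpa using this.symm
    _ = ∫ x, ∫ y, ρ y * u x * φ (x + ι y) ∂μ ∂m := integral_integral_swap h2
    _ = ∫ x, u x * shiftAvg μ ι ρ φ x ∂m := by
        refine integral_congr_ae (Filter.Eventually.of_forall fun x => ?_)
        simp only [shiftAvg]
        rw [← integral_const_mul]
        exact integral_congr_ae (Filter.Eventually.of_forall fun y => by ring)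

theorem ae_eq_zero_of_integral_mul_eq_zero {O : Set X} (hO : IsOpen O) (hu : Integrable u m)
    (h : ∀ φ : X → ℂ, ContDiff ℝ ∞ φ → HasCompactSupport φ → tsupport φ ⊆ O →
      ∫ x, u x * φ x ∂m = 0) : ∀ᵐ x ∂m, x ∈ O → u x = 0 := by
  refine hO.ae_eq_zero_of_integral_contDiff_smul_eq_zero
    (hu.locallyIntegrable.locallyIntegrableOn O) fun g hg hgc hgs => ?_
  have h1 := h (fun x => (g x : ℂ)) (Complex.ofRealCLM.contDiff.comp hg)
    (hgc.comp_left Complex.ofReal_zero)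
    ((closure_mono fun x hx => by simpa using hx).trans hgs)
  rw [← h1]
  exact integral_congr_ae (Filter.Eventually.of_forall fun x => by
    simp only [Complex.real_smul]; ring)

end Conv

variable {V W : Type*} [NormedAddCommGroup V] [NormedSpace ℝ V] [FiniteDimensional ℝ V]
  [MeasurableSpace V] [BorelSpace V] [SecondCountableTopology V] {μ : Measure V}
  [μ.IsAddHaarMeasure]
  [NormedAddCommGroup W] [NormedSpace ℝ W] [FiniteDimensional ℝ W]
  [MeasurableSpace W] [BorelSpace W] [SecondCountableTopology W] {ν : Measure W}
  [ν.IsAddHaarMeasure] {a b : V}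

theorem tsupport_shiftAvg_inr {G : V → ℂ} {φ : W × V → ℂ} {ε r : ℝ}
    (hG : ∀ y, ε ≤ ‖y‖ → G y = 0) (hc : HasCompactSupport φ) {U : Set W}
    (hs : tsupport φ ⊆ U ×ˢ Metric.ball 0 r) :
    tsupport (shiftAvg μ (ContinuousLinearMap.inr ℝ W V) G φ) ⊆ U ×ˢ Metric.ball 0 (r + ε) := by
  intro x hx
  obtain ⟨y, hy, hxy⟩ := (support_shiftAvg_subset hG hc).2 x hx
  obtain ⟨h1, h2⟩ := hs hxy
  refine ⟨by simpa using h1, ?_⟩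
  rw [mem_ball_zero_iff] at h2 ⊢
  have h3 : x.2 = (x + ContinuousLinearMap.inr ℝ W V y).2 - y := by simp
  rw [h3]
  exact (norm_sub_le _ _).trans_lt (by linarith)

/-- Substituting `y ↦ v - y` moves the translation from `u` onto `ρ`. On a slice the convolution is
then as smooth as `ρ`, however rough `u` is. -/
theorem conv_slice (ρ : V → ℂ) (u : W × V → ℂ) (w : W) (v : V) :
    ∫ y, ρ y * u ((w, v) - ContinuousLinearMap.inr ℝ W V y) ∂μ =
      shiftAvg μ (-ContinuousLinearMap.id ℝ V) (fun y => u (w, y)) ρ v := by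
  have h := integral_sub_left_eq_self (fun y => ρ y * u (w, v - y)) μ v
  simp only [shiftAvg]
  have h2 : ∀ y, ρ y * u ((w, v) - ContinuousLinearMap.inr ℝ W V y) = ρ y * u (w, v - y) :=
    fun y => by simp
  simp only [h2]
  rw [← h]
  refine integral_congr_ae (Filter.Eventually.of_forall fun y => ?_)
  simp only [sub_sub_cancel, neg_apply, ContinuousLinearMap.id_apply,
    ← sub_eq_add_neg]
  ring

/-- Elliptic regularity along the slices: an integrable distributional solution on `U × ball 0 r`
of the equation `∏ (∂ - s) u = 0`, with `∂` acting along `V`, agrees on almost every slice with a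
smooth classical solution. -/
theorem exists_smooth_slices (hfs : HasFundamentalSolution μ a b) (l : V →L[ℝ] ℂ)
    (hl : l a + Complex.I * l b = 1) {U : Set W} (hU : IsOpen U) (S : List ℂ) (r r' : ℝ)
    (hr : r' < r) (u : W × V → ℂ) (hu : Integrable u (ν.prod μ))
    (hw : ∀ φ : W × V → ℂ, ContDiff ℝ ∞ φ → HasCompactSupport φ →
      tsupport φ ⊆ U ×ˢ Metric.ball 0 r →
      ∫ x, u x * constOp (ContinuousLinearMap.inr ℝ W V (-a))
        (ContinuousLinearMap.inr ℝ W V (-b)) S φ x ∂(ν.prod μ) = 0) :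
    ∀ᵐ w ∂ν, w ∈ U → ∃ h : V → ℂ, ContDiff ℝ ∞ h ∧
      (∀ v ∈ Metric.ball (0 : V) r', constOp a b S h v = 0) ∧
      ∀ᵐ v ∂μ, v ∈ Metric.ball (0 : V) r' → u (w, v) = h v := by
  induction S generalizing r u with
  | nil =>
    have h0 := ae_eq_zero_of_integral_mul_eq_zero (hU.prod Metric.isOpen_ball) hu hw
    filter_upwards [Measure.ae_ae_of_ae_prod h0] with w hw0 hwU
    refine ⟨fun _ => 0, contDiff_const, fun v _ => rfl, ?_⟩
    filter_upwards [hw0] with v hv hvr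
    exact hv ⟨hwU, Metric.ball_subset_ball hr.le hvr⟩
  | cons s S ih =>
    set ι := ContinuousLinearMap.inr ℝ W V with hι
    -- Each factor costs half of the remaining gap: averaging over radius `(r - r') / 2` takes test
    -- functions on the ball of radius `(r + r') / 2` to test functions on the ball of radius `r`.
    have hε : 0 < (r - r') / 2 := by linarith
    obtain ⟨G, ρ, hG, hGε, hρ, hρε, hpar⟩ := hfs.exists_parametrix l hl s hε
    have hrr : (r + r') / 2 + (r - r') / 2 = r := by ring
    have hρc : HasCompactSupport ρ :=
      HasCompactSupport.of_support_subset_isCompact (isCompact_closedBall 0 ((r - r') / 2)) (by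
        intro y hy
        by_contra hy'
        rw [mem_closedBall_zero_iff, not_le] at hy'
        exact hy (hρε y hy'.le))
    have hρi : Integrable ρ μ := hρ.continuous.integrable_of_hasCompactSupport hρc
    set τ := constOp a b (s :: S) ρ with hτ
    have hτs : ContDiff ℝ ∞ τ := contDiff_constOp hρ
    have hτc : HasCompactSupport τ := hasCompactSupport_constOp hρc
    have hτi : Integrable τ μ := hτs.continuous.integrable_of_hasCompactSupport hτc
    -- The parametrix identity on each translate of `φ`: up to the smoothing average with `ρ`, `φ`
    -- is the transposed factor `-∂ - s` applied to its average with `G`.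
    have hdec : ∀ φ : W × V → ℂ, ContDiff ℝ ∞ φ → HasCompactSupport φ → φ = fun x =>
        shiftAvg μ ι ρ φ x + (cDeriv (ι (-a)) (ι (-b)) (shiftAvg μ ι G φ) x -
          s * shiftAvg μ ι G φ x) := by
      intro φ hφ hφc
      funext x
      have h2 := congrFun (cDeriv_sub_shiftAvg (ι := ι) hG hφ hφc (ι (-a)) (ι (-b)) s) x
      rw [h2]
      have h1 := hpar (fun y => φ (x + ι y)) (hφ.comp (contDiff_const.add ι.contDiff))
      rw [map_zero, add_zero] at h1
      refine h1.trans (congrArg _ (integral_congr_ae (Filter.Eventually.of_forall fun y => ?_)))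
      simp only [cDeriv_comp_shift hφ, map_neg, cDeriv_neg_neg]
    have hsm : ∀ {K : V → ℂ} {φ : W × V → ℂ}, Integrable K μ → ContDiff ℝ ∞ φ →
        HasCompactSupport φ → ContDiff ℝ ∞ (shiftAvg μ ι K φ) := fun hK hφ hφc =>
      contDiff_shiftAvg hK hφ hφc
    set C : W × V → ℂ := fun x => ∫ y, ρ y * u (x - ι y) ∂μ with hC
    have hCi : Integrable C (ν.prod μ) := integrable_conv hρi hu
    set Cτ : W × V → ℂ := fun x => ∫ y, τ y * u (x - ι y) ∂μ with hCτ
    have hCτi : Integrable Cτ (ν.prod μ) := integrable_conv hτi hu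
    -- Subtracting the smoothed part `C = ρ * u` removes the factor `s`: by the parametrix, `u - C`
    -- solves the equation for the shorter list `S`.
    have hIH := ih ((r + r') / 2) (by linarith) (fun x => u x - C x) (hu.sub hCi) (by
      intro φ hφ hφc hφs
      set Φ := constOp (ι (-a)) (ι (-b)) S φ with hΦ
      have hΦs : ContDiff ℝ ∞ Φ := contDiff_constOp hφ
      have hΦc : HasCompactSupport Φ := hasCompactSupport_constOp hφc
      have hbdd : ∀ f : W × V → ℂ, Integrable f (ν.prod μ) → ∀ ψ : W × V → ℂ, ContDiff ℝ ∞ ψ →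
          HasCompactSupport ψ → Integrable (fun x => f x * ψ x) (ν.prod μ) := by
        intro f hf ψ hψ hψc
        obtain ⟨B, hB⟩ := hψc.exists_bound_of_continuous hψ.continuous
        exact hf.mul_bdd (c := B) hψ.continuous.aestronglyMeasurable
          (Filter.Eventually.of_forall hB)
      have hΦdec : Φ = fun x => shiftAvg μ ι ρ Φ x +
          constOp (ι (-a)) (ι (-b)) (s :: S) (shiftAvg μ ι G φ) x := by
        conv_lhs => rw [hΦ, hdec φ hφ hφc]
        rw [constOp_add (hsm hρi hφ hφc) (contDiff_cDeriv_sub (hsm hG hφ hφc) s),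
          constOp_shiftAvg hρi hφ hφc, constOp_cons]
      have hGc : HasCompactSupport (shiftAvg μ ι G φ) := (support_shiftAvg_subset hGε hφc).1
      have hRc : HasCompactSupport (shiftAvg μ ι ρ Φ) := (support_shiftAvg_subset hρε hΦc).1
      have hzero := hw (shiftAvg μ ι G φ) (hsm hG hφ hφc) hGc
        (by simpa only [hrr] using tsupport_shiftAvg_inr hGε hφc hφs)
      have h1 : ∫ x, u x * Φ x ∂(ν.prod μ) = ∫ x, u x * shiftAvg μ ι ρ Φ x ∂(ν.prod μ) := by
        conv_lhs => rw [hΦdec]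
        simp only [mul_add]
        rw [integral_add (hbdd u hu _ (hsm hρi hΦs hΦc) hRc)
          (hbdd u hu _ (contDiff_constOp (hsm hG hφ hφc)) (hasCompactSupport_constOp hGc)),
          hzero, add_zero]
      simp only [sub_mul]
      rw [integral_sub (hbdd u hu Φ hΦs hΦc) (hbdd C hCi Φ hΦs hΦc), h1,
        integral_conv_mul hρi hu hΦs.continuous hΦc, sub_self])
    -- `Cτ` is the full operator applied to `C`. It vanishes because, moved onto the test function,
    -- the operator meets the equation for `u`.
    have hCτ0 := ae_eq_zero_of_integral_mul_eq_zero
      (hU.prod (Metric.isOpen_ball (x := (0 : V)) (ε := (r + r') / 2))) hCτi (by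
      intro φ hφ hφc hφs
      rw [integral_conv_mul hτi hu hφ.continuous hφc, hτ, shiftAvg_constOp_left hρ hρc hφ,
        ← constOp_shiftAvg hρi hφ hφc]
      exact hw _ (hsm hρi hφ hφc) (support_shiftAvg_subset hρε hφc).1
        (by simpa only [hrr] using tsupport_shiftAvg_inr hρε hφc hφs))
    filter_upwards [hIH, Measure.ae_ae_of_ae_prod hCτ0, hu.prod_right_ae] with w hw1 hw2 hw3 hwU
    obtain ⟨h, hh, hh0, hhu⟩ := hw1 hwU
    set k := shiftAvg μ (-ContinuousLinearMap.id ℝ V) (fun y => u (w, y)) ρ with hk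
    have hks : ContDiff ℝ ∞ k := contDiff_shiftAvg hw3 hρ hρc
    have hkτ : ∀ v, constOp a b (s :: S) k v = Cτ (w, v) := fun v => by
      rw [hk, constOp_shiftAvg hw3 hρ hρc, hCτ]
      exact (conv_slice τ u w v).symm
    have hk0 : ∀ v ∈ Metric.ball (0 : V) ((r + r') / 2), constOp a b (s :: S) k v = 0 := by
      have hae : constOp a b (s :: S) k =ᵐ[μ.restrict (Metric.ball 0 ((r + r') / 2))]
          fun _ => 0 := by
        rw [Filter.EventuallyEq, ae_restrict_iff' Metric.isOpen_ball.measurableSet]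
        filter_upwards [hw2] with v hv hvb
        rw [hkτ]
        exact hv ⟨hwU, hvb⟩
      exact Measure.eqOn_open_of_ae_eq hae Metric.isOpen_ball
        (contDiff_constOp hks).continuous.continuousOn continuousOn_const
    -- On the slice, `u = (u - C) + C`: `h` is the smooth representative of `u - C` from the
    -- induction, and `k` is `C` itself.
    refine ⟨fun v => h v + k v, hh.add hks, fun v hv => ?_, ?_⟩
    · rw [constOp_add hh hks]
      have h1 : constOp a b (s :: S) h v = 0 := by
        rw [← constOp_comm hh]
        exact constOp_eq_zero_on (S := [s]) Metric.isOpen_ball hh0 v hv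
      show constOp a b (s :: S) h v + constOp a b (s :: S) k v = 0
      rw [h1, hk0 v (Metric.ball_subset_ball (by linarith) hv), add_zero]
    · filter_upwards [hhu] with v hv hvb
      have h2 : C (w, v) = k v := conv_slice ρ u w v
      rw [← hv hvb, ← h2]
      ring

end Regularity

/-! ### A test function orthogonal to all products -/

theorem ContDiffBump.tsupport_ofReal_subset {E : Type*} [NormedAddCommGroup E] [NormedSpace ℝ E]
    [HasContDiffBump E] {c : E} (f : ContDiffBump c) :
    tsupport (fun x => (f x : ℂ)) ⊆ Metric.closedBall c f.rOut := by
  refine closure_minimal (fun x hx => ?_) Metric.isClosed_closedBall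
  have h : x ∈ Function.support f := by simpa using hx
  rw [f.support_eq] at h
  exact Metric.ball_subset_closedBall h

theorem ContDiffBump.integral_ofReal_ne_zero {E : Type*} [NormedAddCommGroup E] [NormedSpace ℝ E]
    [FiniteDimensional ℝ E] [MeasurableSpace E] [BorelSpace E] (μ : Measure E)
    [μ.IsAddHaarMeasure] {c : E} (f : ContDiffBump c) : ∫ x, (f x : ℂ) ∂μ ≠ 0 := by
  rw [integral_complex_ofReal]
  exact_mod_cast f.integral_pos.ne'

section Orthogonality

variable {V W : Type*} [NormedAddCommGroup V] [NormedSpace ℝ V] [FiniteDimensional ℝ V]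
  [MeasurableSpace V] [BorelSpace V] [SecondCountableTopology V] {μ : Measure V}
  [μ.IsAddHaarMeasure]
  [NormedAddCommGroup W] [NormedSpace ℝ W] [FiniteDimensional ℝ W]
  [MeasurableSpace W] [BorelSpace W] [SecondCountableTopology W] {ν : Measure W}
  [ν.IsAddHaarMeasure] {a b : V}

/-- `u` is an integrable function solving `∏ (∂ - s) u = 0` on `O ⊆ W × V` in the sense of
distributions, where `∂` is the derivative along `a + i b` in the second factor. -/
def IsSliceSolution (m : Measure (W × V)) (a b : V) (S : List ℂ) (O : Set (W × V))
    (u : W × V → ℂ) : Prop :=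
  Integrable u m ∧ ∀ φ : W × V → ℂ, ContDiff ℝ ∞ φ → HasCompactSupport φ → tsupport φ ⊆ O →
    ∫ x, u x * constOp (ContinuousLinearMap.inr ℝ W V (-a))
      (ContinuousLinearMap.inr ℝ W V (-b)) S φ x ∂m = 0

/-- A nontrivial test function annihilating all the products of solutions of two equations in the
same direction. -/
theorem exists_orthogonal_testFunction (hfs : HasFundamentalSolution μ a b) (l : V →L[ℝ] ℂ)
    (hl : l a + Complex.I * l b = 1) (S T : List ℂ) {r : ℝ} (hr : 0 < r) :
    ∃ φ : W × V → ℂ, ContDiff ℝ ∞ φ ∧ HasCompactSupport φ ∧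
      tsupport φ ⊆ Metric.ball 0 r ×ˢ Metric.ball 0 r ∧
      (∃ κ : ℂ, ∫ x, Complex.exp (κ * l x.2) * φ x ∂(ν.prod μ) ≠ 0) ∧
      ∀ u₁ u₂ : W × V → ℂ,
        IsSliceSolution (ν.prod μ) a b S (Metric.ball 0 r ×ˢ Metric.ball 0 r) u₁ →
        IsSliceSolution (ν.prod μ) a b T (Metric.ball 0 r ×ˢ Metric.ball 0 r) u₂ →
        Integrable (fun x => u₁ x * u₂ x) (ν.prod μ) →
          ∫ x, u₁ x * u₂ x * φ x ∂(ν.prod μ) = 0 := by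
  obtain ⟨Q, hQ⟩ := exists_constOp_mul a b S T
  -- With `κ` outside `Q`, the operator multiplies `exp (κ l)` by the nonzero number `∏ (κ - s)`.
  obtain ⟨κ, hκ⟩ := Infinite.exists_notMem_finset Q.toFinset
  let η : ContDiffBump (0 : V) := ⟨r / 8, r / 4, by positivity, by linarith⟩
  let ζ : ContDiffBump (0 : W) := ⟨r / 4, r / 2, by positivity, by linarith⟩
  -- The factor `exp (-κ l)` cancels `exp (κ l)` after integration by parts and leaves the positive
  -- integral of the bump `η`.
  set ψ : V → ℂ := fun v => (η v : ℂ) * Complex.exp (-κ * l v) with hψ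
  have hψs : ContDiff ℝ ∞ ψ :=
    (Complex.ofRealCLM.contDiff.comp η.contDiff).mul (contDiff_exp_mul_clm l (-κ))
  have hψt : tsupport ψ ⊆ Metric.closedBall 0 (r / 4) :=
    (tsupport_mul_subset_left).trans η.tsupport_ofReal_subset
  have hψc : HasCompactSupport ψ :=
    (isCompact_closedBall (0 : V) (r / 4)).of_isClosed_subset (isClosed_tsupport _) hψt
  set θ : V → ℂ := constOp (-a) (-b) Q ψ with hθ
  have hθs : ContDiff ℝ ∞ θ := contDiff_constOp hψs
  have hθt : tsupport θ ⊆ Metric.closedBall 0 (r / 4) := tsupport_constOp.trans hψt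
  have hζs : ContDiff ℝ ∞ fun w => (ζ w : ℂ) := Complex.ofRealCLM.contDiff.comp ζ.contDiff
  have hφs : ContDiff ℝ ∞ fun x : W × V => (ζ x.1 : ℂ) * θ x.2 :=
    (hζs.comp contDiff_fst).mul (hθs.comp contDiff_snd)
  have hφt : tsupport (fun x : W × V => (ζ x.1 : ℂ) * θ x.2) ⊆
      Metric.closedBall 0 (r / 2) ×ˢ Metric.closedBall 0 (r / 4) := by
    refine closure_minimal (fun x hx => ?_)
      (Metric.isClosed_closedBall.prod Metric.isClosed_closedBall)
    rw [Function.mem_support] at hx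
    exact ⟨ζ.tsupport_ofReal_subset (subset_tsupport _ (left_ne_zero_of_mul hx)),
      hθt (subset_tsupport _ (right_ne_zero_of_mul hx))⟩
  have hφc : HasCompactSupport (fun x : W × V => (ζ x.1 : ℂ) * θ x.2) :=
    ((isCompact_closedBall _ _).prod (isCompact_closedBall _ _)).of_isClosed_subset
      (isClosed_tsupport _) hφt
  refine ⟨fun x => (ζ x.1 : ℂ) * θ x.2, hφs, hφc, hφt.trans (Set.prod_mono
    (Metric.closedBall_subset_ball (by linarith)) (Metric.closedBall_subset_ball (by linarith))),
    ⟨κ, ?_⟩, ?_⟩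
  · have h1 : ∀ x : W × V, Complex.exp (κ * l x.2) * ((ζ x.1 : ℂ) * θ x.2) =
        (ζ x.1 : ℂ) * (Complex.exp (κ * l x.2) * θ x.2) := fun x => by ring
    simp only [h1]
    rw [integral_prod_mul (fun w => (ζ w : ℂ)) fun v => Complex.exp (κ * l v) * θ v]
    refine mul_ne_zero (ζ.integral_ofReal_ne_zero ν) ?_
    rw [hθ, integral_mul_constOp (contDiff_exp_mul_clm l κ) hψs (Or.inr hψc), neg_neg, neg_neg,
      constOp_exp l hl]
    have h2 : ∀ v, (Q.map fun s => κ - s).prod * Complex.exp (κ * l v) * ψ v =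
        (Q.map fun s => κ - s).prod * (η v : ℂ) := fun v => by
      have h3 : Complex.exp (κ * l v) * Complex.exp (-κ * l v) = 1 := by
        rw [← Complex.exp_add]
        simp
      simp only [hψ]
      linear_combination ((Q.map fun s => κ - s).prod * (η v : ℂ)) * h3
    simp only [h2]
    rw [integral_const_mul]
    refine mul_ne_zero ?_ (η.integral_ofReal_ne_zero μ)
    rw [ne_eq, List.prod_eq_zero_iff, List.mem_map]
    rintro ⟨s, hs, hs0⟩
    exact hκ (by rw [sub_eq_zero.1 hs0]; simpa using hs)
  · rintro u₁ u₂ ⟨hu₁, hw₁⟩ ⟨hu₂, hw₂⟩ hu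
    obtain ⟨B, hB⟩ := hφc.exists_bound_of_continuous hφs.continuous
    have hi : Integrable (fun x : W × V => u₁ x * u₂ x * ((ζ x.1 : ℂ) * θ x.2)) (ν.prod μ) :=
      hu.mul_bdd (c := B) hφs.continuous.aestronglyMeasurable (Filter.Eventually.of_forall hB)
    rw [integral_prod _ hi]
    have e₁ := exists_smooth_slices hfs l hl Metric.isOpen_ball S r (r / 2) (by linarith) u₁ hu₁ hw₁
    have e₂ := exists_smooth_slices hfs l hl Metric.isOpen_ball T r (r / 2) (by linarith) u₂ hu₂ hw₂
    refine integral_eq_zero_of_ae ?_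
    filter_upwards [e₁, e₂] with w hw₁ hw₂
    by_cases hwU : w ∈ Metric.ball (0 : W) r
    · obtain ⟨h₁, hs₁, hz₁, ha₁⟩ := hw₁ hwU
      obtain ⟨h₂, hs₂, hz₂, ha₂⟩ := hw₂ hwU
      have h3 : ∫ v, u₁ (w, v) * u₂ (w, v) * ((ζ w : ℂ) * θ v) ∂μ =
          ∫ v, (ζ w : ℂ) * (h₁ v * h₂ v * θ v) ∂μ := by
        refine integral_congr_ae ?_
        filter_upwards [ha₁, ha₂] with v hv₁ hv₂
        by_cases hv : v ∈ Metric.ball (0 : V) (r / 2)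
        · rw [hv₁ hv, hv₂ hv]
          ring
        · have : θ v = 0 := image_eq_zero_of_notMem_tsupport fun h =>
            hv (Metric.closedBall_subset_ball (by linarith) (hθt h))
          simp [this]
      have h4 := integral_mul_constOp (μ := μ) (a := -a) (b := -b) (S := Q) (hs₁.mul hs₂) hψs
        (Or.inr hψc)
      -- `θ` is the transposed operator applied to `ψ`; moved back, `Q` annihilates `h₁ h₂` on a
      -- ball containing the support of `ψ`.
      have h5 : ∫ v, h₁ v * h₂ v * θ v ∂μ = 0 := by
        refine h4.trans (integral_eq_zero_of_ae (Filter.Eventually.of_forall fun v => ?_))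
        rw [neg_neg, neg_neg]
        by_cases hv : v ∈ Metric.ball (0 : V) (r / 2)
        · have := hQ h₁ h₂ hs₁ hs₂ _ Metric.isOpen_ball hz₁ hz₂ v hv
          exact mul_eq_zero_of_left this _
        · have : ψ v = 0 := image_eq_zero_of_notMem_tsupport fun h =>
            hv (Metric.closedBall_subset_ball (by linarith) (hψt h))
          simp [this]
      simp only [Pi.zero_apply]
      rw [h3, integral_const_mul, h5, mul_zero]
    · have : (ζ w : ℂ) = 0 := image_eq_zero_of_notMem_tsupport (f := fun w => (ζ w : ℂ)) fun h =>
        hwU (Metric.closedBall_subset_ball (by show r / 2 < r; linarith)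
          (ζ.tsupport_ofReal_subset h))
      simp [this]

end Orthogonality

/-- On a finite measure space a bounded `ψ` lies in the conjugate `L^q` for every `p`, so pairing
with it is a continuous functional that vanishes on a set with dense span. -/
theorem integral_mul_eq_zero_of_dense_span {α : Type*} [MeasurableSpace α] {μ : Measure α}
    [IsFiniteMeasure μ] {p : ℝ≥0∞} [Fact (1 ≤ p)] {s : Set (Lp ℂ p μ)}
    (hs : Dense (Submodule.span ℂ s : Set (Lp ℂ p μ))) {ψ : α → ℂ}
    (hψ : MemLp ψ ⊤ μ) (h : ∀ g ∈ s, ∫ x, g x * ψ x ∂μ = 0) {f : α → ℂ} (hf : MemLp f p μ) :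
    ∫ x, f x * ψ x ∂μ = 0 := by
  have hq : (1 : ℝ≥0∞) ≤ p.conjExponent := le_self_add
  have : Fact (1 ≤ p.conjExponent) := ⟨hq⟩
  have hψq : MemLp ψ p.conjExponent μ := hψ.mono_exponent le_top
  let Λ : Lp ℂ p μ →L[ℂ] ℂ :=
    ((ContinuousLinearMap.mul ℂ ℂ).lpPairing μ p p.conjExponent).flip hψq.toLp
  have hΛ : ∀ g : Lp ℂ p μ, Λ g = ∫ x, g x * ψ x ∂μ := fun g => by
    simp only [Λ, ContinuousLinearMap.flip_apply, ContinuousLinearMap.lpPairing_eq_integral,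
      ContinuousLinearMap.mul_apply']
    refine integral_congr_ae ?_
    filter_upwards [hψq.coeFn_toLp] with x hx
    rw [hx]
  have h0 : Λ = 0 := ContinuousLinearMap.ext_on hs fun g hg => by
    rw [hΛ, h g hg, zero_apply]
  have h1 := hΛ hf.toLp
  rw [h0, zero_apply] at h1
  rw [h1]
  refine integral_congr_ae ?_
  filter_upwards [hf.coeFn_toLp] with x hx
  rw [hx]

/-! ### Operators whose symbol is a product of affine factors -/

section Symbol

variable {n : ℕ}

theorem transposeOp_linPoly_sub_C (α β : Fin n → ℝ) (s : ℂ) {ψ : (Fin n → ℝ) → ℂ}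
    (hψ : ContDiff ℝ ∞ ψ) :
    transposeOp (linPoly (fun i => α i + Complex.I * β i) - MvPolynomial.C s) ψ =
      fun x => cDeriv (-α) (-β) ψ x - s * ψ x := by
  have hsum : ∀ (t : Finset (Fin n)) (c : Fin n → ℂ),
      transposeOp (∑ i ∈ t, MvPolynomial.C (c i) * MvPolynomial.X i) ψ =
        fun x => -∑ i ∈ t, c i * partialDeriv i ψ x := by
    intro t c
    induction t using Finset.cons_induction with
    | empty =>
      have := transposeOp_C 0 ψ
      rw [map_zero, zero_smul] at this
      rw [Finset.sum_empty, this]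
      funext x
      simp
    | cons i t hi ih =>
      rw [Finset.sum_cons, transposeOp_add, ih, transposeOp_C_mul, transposeOp_X i hψ]
      funext x
      simp only [Pi.add_apply, Pi.smul_apply, Pi.neg_apply, smul_eq_mul, Finset.sum_cons]
      ring
  have hfd : ∀ (v : Fin n → ℝ) x, fderiv ℝ ψ x v = ∑ i, (v i : ℂ) * partialDeriv i ψ x := by
    intro v x
    conv_lhs => rw [pi_eq_sum_univ' v]
    simp [partialDeriv, map_sum]
  rw [sub_eq_add_neg, ← map_neg, transposeOp_add, transposeOp_C, linPoly, hsum]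
  funext x
  simp only [cDeriv, hfd, Pi.add_apply, Pi.smul_apply, smul_eq_mul, add_mul,
    Finset.sum_add_distrib, Finset.mul_sum, mul_assoc]
  simp only [Pi.neg_apply, Complex.ofReal_neg, neg_mul, Finset.sum_neg_distrib, mul_neg]
  ring

theorem transposeOp_prod_linPoly_sub_C (α β : Fin n → ℝ) (S : List ℂ) {ψ : (Fin n → ℝ) → ℂ}
    (hψ : ContDiff ℝ ∞ ψ) :
    transposeOp (S.map fun s => linPoly (fun i => α i + Complex.I * β i) - MvPolynomial.C s).prod
      ψ = constOp (-α) (-β) S ψ := by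
  induction S with
  | nil =>
    have := transposeOp_C 1 ψ
    rwa [map_one, one_smul] at this
  | cons s S ih =>
    rw [List.map_cons, List.prod_cons, transposeOp_mul _ _ hψ, ih,
      transposeOp_linPoly_sub_C α β s (contDiff_constOp hψ), constOp_comm hψ]

end Symbol

/-! ### Transfer of the orthogonal test function to `D` -/

section Transfer

variable {V W : Type*} [NormedAddCommGroup V] [NormedSpace ℝ V] [FiniteDimensional ℝ V]
  [MeasurableSpace V] [BorelSpace V] [SecondCountableTopology V] {μ : Measure V}
  [μ.IsAddHaarMeasure]
  [NormedAddCommGroup W] [NormedSpace ℝ W] [FiniteDimensional ℝ W]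
  [MeasurableSpace W] [BorelSpace W] [SecondCountableTopology W] {a b : V} {n : ℕ}

/-- If both operators divide products of first order operators in the same direction, then the
products of the null-space elements are not total. -/
theorem not_productsTotal_of_dvd (hfs : HasFundamentalSolution μ a b) (l : V →L[ℝ] ℂ)
    (hl : l a + Complex.I * l b = 1) (e : (W × V) ≃L[ℝ] (Fin n → ℝ)) (c : Fin n → ℂ)
    (hc : ∀ i, c i = e (0, a) i + Complex.I * e (0, b) i) {D : Set (Fin n → ℝ)} (hD : IsOpen D)
    (hne : D.Nonempty) (hDb : Bornology.IsBounded D) {p : ℝ≥0∞} [Fact (1 ≤ p)]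
    (P₁ P₂ : MvPolynomial (Fin n) ℂ) (S T : List ℂ)
    (h₁ : P₁ ∣ (S.map fun s => linPoly c - MvPolynomial.C s).prod)
    (h₂ : P₂ ∣ (T.map fun s => linPoly c - MvPolynomial.C s).prod) :
    ¬ ProductsTotal D p P₁ P₂ := by
  intro htot
  obtain ⟨x₀, hx₀⟩ := hne
  let ν : Measure W := Measure.addHaar
  set q₀ : W × V := -e.symm x₀ with hq₀
  -- Affine coordinates centred at `x₀ ∈ D`. They carry Lebesgue measure to a positive finite
  -- multiple `k` of the product Haar measure.
  let B : (Fin n → ℝ) ≃ₜ W × V := e.symm.toHomeomorph.trans (Homeomorph.addLeft q₀)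
  have hB : ∀ x, B x = q₀ + e.symm x := fun x => rfl
  have hBe : MeasurableEmbedding B := B.measurableEmbedding
  obtain ⟨k, hk0, hkt, hBm⟩ : ∃ k : ℝ≥0∞, k ≠ 0 ∧ k ≠ ⊤ ∧
      MeasurePreserving B volume (k • ν.prod μ) := by
    have h := Measure.isAddLeftInvariant_eq_smul ((volume : Measure (Fin n → ℝ)).map e.symm)
      (ν.prod μ)
    have hpos := Measure.addHaarScalarFactor_pos_of_isAddHaarMeasure
      ((volume : Measure (Fin n → ℝ)).map e.symm) (ν.prod μ)
    set k := Measure.addHaarScalarFactor ((volume : Measure (Fin n → ℝ)).map e.symm) (ν.prod μ)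
    refine ⟨k, by simpa using hpos.ne', by simp, ?_⟩
    have h1 : MeasurePreserving e.symm volume ((k : ℝ≥0∞) • ν.prod μ) :=
      ⟨e.symm.continuous.measurable, h⟩
    have : ((k : ℝ≥0∞) • ν.prod μ).IsAddLeftInvariant := by
      rw [← h1.map_eq]
      infer_instance
    exact (measurePreserving_add_left _ q₀).comp h1
  have hint : ∀ F : W × V → ℂ, ∫ x, F (B x) = k.toReal * ∫ y, F y ∂(ν.prod μ) := fun F => by
    rw [hBm.integral_comp hBe, integral_smul_measure, Complex.real_smul]
  have hk : (k.toReal : ℂ) ≠ 0 := by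
    exact_mod_cast (ENNReal.toReal_pos hk0 hkt).ne'
  have hBD : IsOpen (B '' D) := B.isOpenMap D hD
  obtain ⟨r, hr, hrD⟩ : ∃ r > 0, Metric.closedBall (0 : W × V) r ⊆ B '' D := by
    refine Metric.nhds_basis_closedBall.mem_iff.1 (hBD.mem_nhds ⟨x₀, hx₀, ?_⟩)
    rw [hB, hq₀, neg_add_cancel]
  set O : Set (W × V) := Metric.ball 0 r ×ˢ Metric.ball 0 r with hO
  have hOo : IsOpen O := Metric.isOpen_ball.prod Metric.isOpen_ball
  have hOr : O ⊆ Metric.closedBall (0 : W × V) r := by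
    rw [hO, ball_prod_same]
    exact Metric.ball_subset_closedBall
  have hOD : B ⁻¹' O ⊆ D := fun x hx => by
    obtain ⟨y, hy, hyx⟩ := hrD (hOr hx)
    rwa [← B.injective hyx]
  obtain ⟨φ, hφs, hφc, hφt, ⟨κ, hκ⟩, hφ⟩ :=
    exists_orthogonal_testFunction (ν := ν) hfs l hl S T hr
  have hψs : ∀ φ : W × V → ℂ, ContDiff ℝ ∞ φ → ContDiff ℝ ∞ fun x => φ (B x) := fun φ hφ =>
    hφ.comp (contDiff_const.add e.symm.contDiff)
  have hψc : ∀ φ : W × V → ℂ, HasCompactSupport φ → HasCompactSupport fun x => φ (B x) :=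
    fun φ hφ => hφ.comp_homeomorph B
  have hψt : ∀ φ : W × V → ℂ, tsupport φ ⊆ O → tsupport (fun x => φ (B x)) ⊆ B ⁻¹' O :=
    fun φ hφ => (tsupport_comp_subset_preimage φ B.continuous).trans (Set.preimage_mono hφ)
  have hsol : ∀ (P : MvPolynomial (Fin n) ℂ) (R : List ℂ),
      P ∣ (R.map fun s => linPoly c - MvPolynomial.C s).prod → ∀ w ∈ nullSpace D P,
        -- Cutting off outside `O` is invisible to test functions supported in `O`. It makes `w`
        -- integrable, because `O` lies in a closed ball whose preimage is a compact subset of `D`.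
        IsSliceSolution (ν.prod μ) a b R O (O.indicator fun y => w (B.symm y)) := by
    intro P R hPR w hw
    obtain ⟨hwi, hw0⟩ := nullSpace_subset_of_dvd hPR hw
    refine ⟨?_, fun φ hφs hφc hφt => ?_⟩
    · rw [integrable_indicator_iff hOo.measurableSet, IntegrableOn,
        ← integrable_smul_measure hk0 hkt, ← Measure.restrict_smul, ← IntegrableOn,
        ← hBm.integrableOn_comp_preimage hBe]
      have h3 : (fun y => w (B.symm y)) ∘ B = w := by
        funext x
        simp
      rw [h3]
      have hK : IsCompact (B ⁻¹' Metric.closedBall 0 r) :=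
        B.isCompact_preimage.2 (isCompact_closedBall _ _)
      refine (hwi.integrableOn_compact_subset (fun x hx => ?_) hK).mono_set
        (Set.preimage_mono hOr)
      obtain ⟨y, hy, hyx⟩ := hrD hx
      rwa [← B.injective hyx]
    · have h3 := hw0 _ (hψs φ hφs) (hψc φ hφc) ((hψt φ hφt).trans hOD)
      have hc' : c = fun i => (e (0, a) i : ℂ) + Complex.I * e (0, b) i := funext hc
      rw [hc', transposeOp_prod_linPoly_sub_C _ _ _ (hψs φ hφs)] at h3
      have h4 : ∀ x, constOp (-e (0, a)) (-e (0, b)) R (fun x => φ (B x)) x =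
          constOp (ContinuousLinearMap.inr ℝ W V (-a)) (ContinuousLinearMap.inr ℝ W V (-b)) R φ
            (B x) := fun x => by
        have := constOp_comp_shift (ι := (e.symm : (Fin n → ℝ) →L[ℝ] W × V)) hφs
          (-e (0, a)) (-e (0, b)) R q₀ x
        have h5 : ∀ v : V, (e.symm : (Fin n → ℝ) →L[ℝ] W × V) (-e (0, v)) =
            ContinuousLinearMap.inr ℝ W V (-v) := fun v => by simp
        rw [h5, h5] at this
        exact this
      have h6 : ∀ y ∉ O, constOp (ContinuousLinearMap.inr ℝ W V (-a))
          (ContinuousLinearMap.inr ℝ W V (-b)) R φ y = 0 := fun y hy =>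
        image_eq_zero_of_notMem_tsupport fun h => hy (hφt (tsupport_constOp h))
      refine (mul_eq_zero.1 ((hint _).symm.trans ?_)).resolve_left hk
      rw [← h3]
      rw [setIntegral_eq_integral_of_forall_compl_eq_zero]
      · refine integral_congr_ae (Filter.Eventually.of_forall fun x => ?_)
        simp only [h4]
        by_cases hx : B x ∈ O
        · rw [Set.indicator_of_mem hx, B.symm_apply_apply]
        · rw [h6 _ hx, mul_zero, mul_zero]
      · intro x hx
        rw [h4, h6 _ fun h => hx (hOD h), mul_zero]
  have : IsFiniteMeasure (volume.restrict D) :=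
    ⟨by simpa using hDb.measure_lt_top⟩
  obtain ⟨M, hM⟩ := hφc.exists_bound_of_continuous hφs.continuous
  have hψ : MemLp (fun x => φ (B x)) ⊤ (volume.restrict D) :=
    MemLp.of_bound (hφs.continuous.comp B.continuous).aestronglyMeasurable M
      (Filter.Eventually.of_forall fun x => hM _)
  have hφ0 : ∀ y ∉ O, φ y = 0 := fun y hy =>
    image_eq_zero_of_notMem_tsupport fun h => hy (hφt h)
  have hlc : Continuous fun y : W × V => Complex.exp (κ * l y.2) := by fun_prop
  have hfB : Continuous fun x => Complex.exp (κ * l (B x).2) := hlc.comp B.continuous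
  obtain ⟨M', hM'⟩ := hDb.isCompact_closure.exists_bound_of_continuousOn hfB.continuousOn
  have hf : MemLp (fun x => Complex.exp (κ * l (B x).2)) p (volume.restrict D) :=
    MemLp.of_bound hfB.aestronglyMeasurable M'
      ((ae_restrict_mem hD.measurableSet).mono fun x hx => hM' x (subset_closure hx))
  -- If the products were total, the transported test function would annihilate all of `L^p(D)`,
  -- including `exp (κ l)`, against which its integral is nonzero.
  have hzero := integral_mul_eq_zero_of_dense_span htot hψ ?_ hf
  · rw [setIntegral_eq_integral_of_forall_compl_eq_zero fun x hx => by
      rw [hφ0 _ fun h => hx (hOD h), mul_zero]] at hzero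
    rw [hint fun y => Complex.exp (κ * l y.2) * φ y] at hzero
    exact (mul_ne_zero hk hκ) hzero
  · rintro g ⟨w₁, hw₁, w₂, hw₂, hg⟩
    have h3 := hφ _ _ (hsol P₁ S h₁ w₁ hw₁) (hsol P₂ T h₂ w₂ hw₂) ?_
    · rw [integral_congr_ae (g := fun x => w₁ x * w₂ x * φ (B x))
        (hg.mono fun x hx => by simp only [hx])]
      rw [setIntegral_eq_integral_of_forall_compl_eq_zero fun x hx => by
        rw [hφ0 _ fun h => hx (hOD h), mul_zero]]
      have h4 := hint fun y => O.indicator (fun y => w₁ (B.symm y)) y *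
        O.indicator (fun y => w₂ (B.symm y)) y * φ y
      rw [h3, mul_zero] at h4
      rw [← h4]
      refine integral_congr_ae (Filter.Eventually.of_forall fun x => ?_)
      by_cases hx : B x ∈ O
      · simp [Set.indicator_of_mem hx]
      · simp [hφ0 _ hx]
    · have h5 : (fun y => O.indicator (fun y => w₁ (B.symm y)) y *
          O.indicator (fun y => w₂ (B.symm y)) y) =
          O.indicator fun y => w₁ (B.symm y) * w₂ (B.symm y) := by
        rw [← Set.indicator_mul]
      rw [h5, integrable_indicator_iff hOo.measurableSet, IntegrableOn,
        ← integrable_smul_measure hk0 hkt, ← Measure.restrict_smul, ← IntegrableOn,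
        ← hBm.integrableOn_comp_preimage hBe]
      have h6 : (fun y => w₁ (B.symm y) * w₂ (B.symm y)) ∘ B = fun x => w₁ x * w₂ x := by
        funext x
        simp
      rw [h6]
      have h7 : IntegrableOn (fun x => w₁ x * w₂ x) D :=
        ((Lp.memLp g).integrable Fact.out).congr hg
      exact h7.mono_set hOD

end Transfer

/-! ### Real and genuinely complex directions -/

section Conclusion

variable {n : ℕ}

/-- A complement of the range of `f` supplies the coordinates `W = ℝᵏ` in which the operator does
not act. -/
theorem exists_continuousLinearEquiv_prod {V : Type*} [NormedAddCommGroup V] [NormedSpace ℝ V]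
    [FiniteDimensional ℝ V] (f : V →ₗ[ℝ] (Fin n → ℝ)) (hf : Function.Injective f) :
    ∃ (k : ℕ) (e : ((Fin k → ℝ) × V) ≃L[ℝ] (Fin n → ℝ)), ∀ v, e (0, v) = f v := by
  obtain ⟨q, hq⟩ := Submodule.exists_isCompl (LinearMap.range f)
  let g : (Fin (Module.finrank ℝ q) → ℝ) ≃ₗ[ℝ] q := (Module.finBasis ℝ q).equivFun.symm
  let e : ((Fin (Module.finrank ℝ q) → ℝ) × V) ≃ₗ[ℝ] (Fin n → ℝ) :=
    (g.prodCongr (LinearEquiv.ofInjective f hf)).trans (Submodule.prodEquivOfIsCompl _ _ hq.symm)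
  refine ⟨_, e.toContinuousLinearEquiv, fun v => ?_⟩
  simp [e]

/-- Rescaling the direction rescales the shifts `s` and costs only a unit factor in each term. -/
theorem exists_dvd_prod_of_smul {c d : Fin n → ℂ} {lam : ℂ} (hlam : lam ≠ 0)
    (hcd : ∀ i, c i = lam * d i) {P : MvPolynomial (Fin n) ℂ} {S : List ℂ}
    (h : P ∣ (S.map fun s => linPoly c - MvPolynomial.C s).prod) :
    ∃ T : List ℂ, P ∣ (T.map fun s => linPoly d - MvPolynomial.C s).prod := by
  refine ⟨S.map fun s => lam⁻¹ * s, h.trans ?_⟩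
  have h1 : ∀ s, linPoly c - MvPolynomial.C s =
      MvPolynomial.C lam * (linPoly d - MvPolynomial.C (lam⁻¹ * s)) := fun s => by
    rw [mul_sub, ← MvPolynomial.C_mul, mul_inv_cancel_left₀ hlam, linPoly, linPoly,
      Finset.mul_sum]
    congr 1
    refine Finset.sum_congr rfl fun i _ => ?_
    rw [hcd, MvPolynomial.C_mul, mul_assoc]
  rw [List.map_map]
  clear h
  induction S with
  | nil => simp
  | cons s S ih =>
    simp only [List.map_cons, List.prod_cons, Function.comp_apply]
    refine mul_dvd_mul ?_ ih
    rw [h1]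
    have hu : IsUnit (MvPolynomial.C lam : MvPolynomial (Fin n) ℂ) :=
      (isUnit_iff_ne_zero.2 hlam).map MvPolynomial.C
    exact hu.mul_left_dvd.2 dvd_rfl

theorem exists_smul_real_or_linearIndependent {c : Fin n → ℂ} (hc : c ≠ 0) :
    (∃ lam : ℂ, lam ≠ 0 ∧ ∃ α : Fin n → ℝ, α ≠ 0 ∧ ∀ i, c i = lam * α i) ∨
      LinearIndependent ℝ ![fun i => (c i).re, fun i => (c i).im] := by
  by_cases h : LinearIndependent ℝ ![fun i => (c i).re, fun i => (c i).im]
  · exact Or.inr h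
  left
  have h' : ¬ ∀ s t : ℝ, s • (fun i => (c i).re) + t • (fun i => (c i).im) = 0 → s = 0 ∧ t = 0 := by
    rwa [← LinearIndependent.pair_iff]
  push Not at h'
  obtain ⟨s, t, hst, h0⟩ := h'
  have hst' : ∀ i, s * (c i).re + t * (c i).im = 0 := fun i => congrFun hst i
  have hne : s ^ 2 + t ^ 2 ≠ 0 := by
    by_cases hs : s = 0
    · have := h0 hs
      positivity
    · positivity
  -- From `s Re c + t Im c = 0`, the vector `(Re c, Im c)` is in each coordinate a real multiple of
  -- `(-t, s)`; `α` is that multiple.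
  refine ⟨⟨-t, s⟩, fun h => ?_, fun i => (s * (c i).im - t * (c i).re) / (s ^ 2 + t ^ 2),
    fun h => hc ?_, fun i => ?_⟩
  · have h1 := congrArg Complex.re h
    have h2 := congrArg Complex.im h
    simp at h1 h2
    exact h0 h2 h1
  · funext i
    have h1 : (s * (c i).im - t * (c i).re) / (s ^ 2 + t ^ 2) = 0 := congrFun h i
    have h2 : s * (c i).im - t * (c i).re = 0 := by simpa [hne] using h1
    have h3 := hst' i
    apply Complex.ext
    · have : (s ^ 2 + t ^ 2) * (c i).re = 0 := by linear_combination s * h3 - t * h2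
      simpa [hne] using this
    · have : (s ^ 2 + t ^ 2) * (c i).im = 0 := by linear_combination t * h3 + s * h2
      simpa [hne] using this
  · have h3 := hst' i
    apply Complex.ext
    · simp only [Complex.mul_re, Complex.ofReal_re, Complex.ofReal_im, mul_zero, sub_zero]
      field_simp
      linear_combination s * h3
    · simp only [Complex.mul_im, Complex.ofReal_re, Complex.ofReal_im, mul_zero, zero_add]
      field_simp
      linear_combination t * h3

/-- When `c` is a complex multiple of a real vector the operator is `d/dx` on `V = ℝ`. Otherwise `Re
c` and `Im c` span a real plane, identified with `V = ℂ`, and the operator is `∂_x + i ∂_y`. -/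
theorem not_productsTotal_of_not_transversal {D : Set (Fin n → ℝ)} (hD : IsOpen D)
    (hne : D.Nonempty) (hDb : Bornology.IsBounded D) {p : ℝ≥0∞} [Fact (1 ≤ p)]
    (P₁ P₂ : MvPolynomial (Fin n) ℂ) (hP₁ : 1 ≤ P₁.totalDegree) (hP₂ : 1 ≤ P₂.totalDegree)
    (hT : ¬ VarietiesTransversal (charVariety P₁) (charVariety P₂)) :
    ¬ ProductsTotal D p P₁ P₂ := by
  obtain ⟨c, hc, ⟨S, hS⟩, ⟨T, hT⟩, -⟩ := exists_list_of_not_transversal P₁ P₂ hP₁ hP₂ hT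
  rcases exists_smul_real_or_linearIndependent hc with ⟨lam, hlam, α, hα, hcα⟩ | hli
  · obtain ⟨S', hS'⟩ := exists_dvd_prod_of_smul hlam hcα hS
    obtain ⟨T', hT'⟩ := exists_dvd_prod_of_smul hlam hcα hT
    obtain ⟨k, e, he⟩ := exists_continuousLinearEquiv_prod (LinearMap.toSpanSingleton ℝ _ α)
      (smul_left_injective ℝ hα)
    refine not_productsTotal_of_dvd hasFundamentalSolution_real Complex.ofRealCLM (by simp) e _
      (fun i => ?_) hD hne hDb P₁ P₂ S' T' hS' hT'
    simp [he]
  · let f : ℂ →ₗ[ℝ] (Fin n → ℝ) :=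
      Complex.reLm.smulRight (fun i => (c i).re) + Complex.imLm.smulRight fun i => (c i).im
    have hf : ∀ z : ℂ, f z = z.re • (fun i => (c i).re) + z.im • fun i => (c i).im := fun z => rfl
    have hinj : Function.Injective f := by
      rw [injective_iff_map_eq_zero]
      intro z hz
      rw [hf] at hz
      obtain ⟨h1, h2⟩ := LinearIndependent.pair_iff.1 hli _ _ hz
      exact Complex.ext h1 h2
    obtain ⟨k, e, he⟩ := exists_continuousLinearEquiv_prod f hinj
    refine not_productsTotal_of_dvd hasFundamentalSolution_complex
      -- The functional `l = z̄ / 2` satisfies `(∂_x + i ∂_y) l = 1`; a holomorphic `l` would give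
      -- `0`.
      ((1 / 2 : ℝ) • (Complex.conjCLE : ℂ →L[ℝ] ℂ)) ?_ e c
      (fun i => ?_) hD hne hDb P₁ P₂ S T hS hT
    · simp
      ring_nf
      simp
      norm_num
    · simp only [he, hf]
      simp [mul_comm Complex.I, Complex.re_add_im]

end Conclusion

/-! ### The theorem -/

theorem theorem3p3 {n : ℕ} (hn : 2 ≤ n) (P₁ P₂ : MvPolynomial (Fin n) ℂ)
    (hP₁ : 1 ≤ P₁.totalDegree) (hP₂ : 1 ≤ P₂.totalDegree) :
    (∀ D : Set (Fin n → ℝ), IsOpen D → IsConnected D → Bornology.IsBounded D →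
      (HasPropertyC D P₁ P₂ ↔ VarietiesTransversal (charVariety P₁) (charVariety P₂)) ∧
      (∀ (p : ℝ≥0∞) [Fact (1 ≤ p)], p ≠ ⊤ →
        (ProductsTotal D p P₁ P₂ ↔
          VarietiesTransversal (charVariety P₁) (charVariety P₂)))) ∧
    (¬ VarietiesTransversal (charVariety P₁) (charVariety P₂) ↔
      IsUnionOfParallelHyperplanes (charVariety P₁ ∪ charVariety P₂)) := by

  have key : ∀ D : Set (Fin n → ℝ), IsOpen D → IsConnected D → Bornology.IsBounded D →
      ∀ (p : ℝ≥0∞) [Fact (1 ≤ p)], p ≠ ⊤ → (ProductsTotal D p P₁ P₂ ↔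
        VarietiesTransversal (charVariety P₁) (charVariety P₂)) :=
    fun D hD hDc hDb p _ hp =>
      ⟨fun h => by_contra fun hT =>
        not_productsTotal_of_not_transversal hD hDc.nonempty hDb P₁ P₂ hP₁ hP₂ hT h,
      productsTotal_of_transversal hD hDb hp P₁ P₂ hP₁ hP₂⟩
  refine ⟨fun D hD hDc hDb => ⟨⟨?_, fun hT => ?_⟩, key D hD hDc hDb⟩,
    isUnionOfParallelHyperplanes_of_not_transversal P₁ P₂ hP₁ hP₂,
    not_transversal_of_isUnionOfParallelHyperplanes P₁ P₂ hP₁ hP₂⟩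
  · rintro ⟨p, hp, hpt, h⟩
    exact (key D hD hDc hDb p hpt).1 h
  -- Totality holds for every finite exponent, so `p = 1` serves as the witness.
  · have h1 : Fact ((1 : ℝ≥0∞) ≤ 1) := ⟨le_rfl⟩
    exact ⟨1, h1, ENNReal.one_ne_top, (key D hD hDc hDb 1 ENNReal.one_ne_top).2 hT⟩
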